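/- Let $N$ be a finite set of agents and $A$ a set of items with $|A|=|N|$, and let every item $a$ carry a strict priority ordering $\succ_a$ of the agents. A type $\theta_i$ of an agent $i$ is a strict preference ordering of the items; all such orderings are possible, and $i$ weakly prefers one matching to another iff she weakly prefers her own item in it. In a sub-market (a set of remaining agents and remaining items), the owner of a remaining item is the remaining agent with the highest priority for it. The top trading cycles (TTC) social choice function maps a type profile to the outcome of the algorithm in which, at each stage, the members of the cycles of the map "agent $\mapsto$ owner of her favorite remaining item" leave with their favorite remaining items. The Renunciation-Designation-Assertion (RDA) implementation for the given priorities is the following dynamic game form, which proceeds in stages. (1) An owner is active at a stage unless she has previously designated a trading partner who still remains. (2) Renunciation: all active owners simultaneously either claim ("my favorite remaining item is one of my own") or renounce. (3) If nobody claims, designation: all active owners simultaneously each designate the owner of their favorite remaining item. (4) Assertion: the owners who have just claimed or, if a designation has taken place, the owners lying on a cycle of current designations simultaneously each choose an item and leave with it. An owner who claimed chooses among her own items; an owner on a cycle chooses among the items that her designated partner owned when she designated him. Then the next stage begins. An action of an agent is the non-empty set of those of her types that are compatible with her previous action and for which the corresponding answer is truthful; answers contradicting her previous reports are unavailable. At the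 initial history non-owners make a degenerate move (they report their whole type space). When she moves, an agent knows the sub-stage, the set of remaining owners and the set of remaining items, and recalls what she knew and did at her own earlier moves; she learns nothing else. A game form with perfect recall in which all agents are active at the initial history is a gradual mechanism implementing a social choice function $f$ if (a) actions are non-empty sets of one's own types, (b) the actions available to an agent at a decision node partition her last action (her whole type space if she has not acted), and (c) the outcome of a terminal history $z$ is $f(\theta)$ for every type profile $\theta$ all of whose components lie in the last actions along $z$. It is incentive compatible if for every agent $i$, every type $\theta_i$, every strategy $s_{\theta_i}$ which chooses an action containing $\theta_i$ at each decision node of $i$ at which $\theta_i$ belongs to $i$'s last action (or $i$ has not acted), every strategy $s_i$ and every profile $s_{-i}$ of strategies of the others, type $\theta_i$ weakly prefers the outcome of $(s_{\theta_i},s_{-i})$ to the outcome of $(s_i,s_{-i})$. Proposition. For every priority structure, the TTC outcome is a matching of all agents with all items for every type profile, and the RDA implementation is a gradual mechanism implementing the TTC social choice function and is incentive compatible. -/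

import Mathlib

/-! ## Dynamic game forms -/

/-- An action profile: `a i = none` means that player `i` does not move. -/
abbrev ActionProfile {N : Type*} (Act : N → Type*) := ∀ i, Option (Act i)

/-- A history is a finite sequence of action profiles, written with the MOST RECENT profile first,
so that `a :: h` is the history `h` followed by `a`, and "`h` weakly precedes `h'`" is the suffix
relation `h <:+ h'`. -/
abbrev History {N : Type*} (Act : N → Type*) := List (ActionProfile Act)

/-- The data of a dynamic game form: the set of all (terminal and non-terminal) histories, for
each player the relation "these two decision nodes lie in the same information set", and the
outcome function (only its values at terminal histories matter). -/
structure GameForm {N : Type*} (Act : N → Type*) (X : Type*) where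
  hist : Set (History Act)
  sameInfo : N → History Act → History Act → Prop
  outcome : History Act → X

namespace GameForm

section General

variable {N : Type*} {Act : N → Type*} {X : Type*} (G : GameForm Act X)

/-- The actions available to player `i` at the history `h`. -/
def available (i : N) (h : History Act) : Set (Act i) :=
  {x | ∃ a, a :: h ∈ G.hist ∧ a i = some x}

/-- Player `i` is active at `h`, that is, `h` is one of her decision nodes. -/
def IsActive (i : N) (h : History Act) : Prop := (G.available i h).Nonempty

/-- Terminal histories. -/
def IsTerminal (z : History Act) : Prop := z ∈ G.hist ∧ ∀ a, a :: z ∉ G.hist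

/-- The sequence of actions taken by player `i` along a history. -/
def ownActions (i : N) (h : History Act) : List (Act i) := h.filterMap fun a => a i

/-- The axioms of a dynamic game form with perfect recall. -/
structure IsDynamicGameForm : Prop where
  nil_mem : [] ∈ G.hist
  pred_mem : ∀ a h, a :: h ∈ G.hist → h ∈ G.hist
  finite_length : ∃ T : ℕ, ∀ h ∈ G.hist, h.length ≤ T
  /-- at every non-terminal history at least one player moves -/
  profile_nonempty : ∀ a h, a :: h ∈ G.hist → ∃ i, (a i).isSome
  /-- the set of players who move at a history depends on the history only -/
  same_movers : ∀ a b h, a :: h ∈ G.hist → b :: h ∈ G.hist → ∀ i, (a i).isSome = (b i).isSome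
  /-- simultaneous choices of available actions are unrestricted -/
  product : ∀ h ∈ G.hist, ¬ G.IsTerminal h → ∀ a : ActionProfile Act,
    (∀ i, G.IsActive i h → ∃ x ∈ G.available i h, a i = some x) →
    (∀ i, ¬ G.IsActive i h → a i = none) → a :: h ∈ G.hist
  /-- every player is active at the initial history -/
  initial_active : ∀ i, G.IsActive i []
  /-- information sets partition the decision nodes -/
  info_equivalence : ∀ i, Equivalence fun h h' : {h // G.IsActive i h} => G.sameInfo i h h'
  available_eq : ∀ i h h', G.IsActive i h → G.IsActive i h' → G.sameInfo i h h' →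
    G.available i h = G.available i h'
  /-- perfect recall of one's own actions -/
  recall_actions : ∀ i h h', G.IsActive i h → G.IsActive i h' → G.sameInfo i h h' →
    ownActions i h = ownActions i h'
  /-- perfect recall of one's own information sets -/
  recall_info : ∀ i h h', G.IsActive i h → G.IsActive i h' → G.sameInfo i h h' →
    ∀ k, k <:+ h → G.IsActive i k → ∃ k', k' <:+ h' ∧ G.IsActive i k' ∧ G.sameInfo i k k'

/-- A pure strategy of player `i`: an available action at each decision node, the same one at
decision nodes in the same information set. (Values elsewhere are irrelevant.) -/
structure Strategy (i : N) where
  act : History Act → Act i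
  act_mem : ∀ h, G.IsActive i h → act h ∈ G.available i h
  act_info : ∀ h h', G.IsActive i h → G.IsActive i h' → G.sameInfo i h h' → act h = act h'

/-- All moves along the history `h` are those prescribed by the strategy profile `s`. -/
def Follows (s : ∀ i, G.Strategy i) : History Act → Prop
  | [] => True
  | a :: h => Follows s h ∧ ∀ i x, a i = some x → x = (s i).act h

/-- `z` is the terminal history reached when the players use the strategy profile `s`. -/
def IsPlay (s : ∀ i, G.Strategy i) (z : History Act) : Prop := G.IsTerminal z ∧ G.Follows s z

end General

section Gradual

variable {N : Type*} {Θ : N → Type*} {X : Type*}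

/-- The last action (a set of types) of agent `i` along `h`; the whole type space if she has not
acted. -/
def lastReport (i : N) : History (fun i => Set (Θ i)) → Set (Θ i)
  | [] => Set.univ
  | a :: h => (a i).getD (lastReport i h)

/-- `G` is a gradual mechanism implementing the social choice function `f`. -/
structure IsGradualMechanism (G : GameForm (fun i => Set (Θ i)) X) (f : (∀ i, Θ i) → X) :
    Prop where
  gameForm : G.IsDynamicGameForm
  nonempty_of_available : ∀ i h, ∀ S ∈ G.available i h, S.Nonempty
  disjoint : ∀ i h, ∀ S ∈ G.available i h, ∀ S' ∈ G.available i h, S ≠ S' → Disjoint S S'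
  sUnion_available : ∀ i h, G.IsActive i h → ⋃₀ G.available i h = lastReport i h
  outcome_eq : ∀ z, G.IsTerminal z → ∀ θ : ∀ i, Θ i, (∀ i, θ i ∈ lastReport i z) →
    G.outcome z = f θ

/-- The strategy `s` is unconditional (truth-telling) for the type `θ`. -/
def IsUnconditional (G : GameForm (fun i => Set (Θ i)) X) {i : N} (s : G.Strategy i) (θ : Θ i) :
    Prop :=
  ∀ h, G.IsActive i h → θ ∈ lastReport i h → θ ∈ s.act h

open Classical in
/-- Incentive compatibility: for every agent `i`, type `θ` of hers, unconditional strategy `u` for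
`θ`, strategy `s i` and profile of strategies of the others, the outcome of `(u, s₋ᵢ)` is weakly
preferred by `θ` to the outcome of `(s i, s₋ᵢ)`. Here `R i θ x y` says that type `θ` of agent `i`
weakly prefers `x` to `y`. -/
def IsIncentiveCompatible (G : GameForm (fun i => Set (Θ i)) X)
    (R : ∀ i, Θ i → X → X → Prop) : Prop :=
  ∀ (i : N) (θ : Θ i) (u : G.Strategy i), G.IsUnconditional u θ →
    ∀ (s : ∀ j, G.Strategy j) (z z' : History fun i => Set (Θ i)),
      G.IsPlay (Function.update s i u) z → G.IsPlay s z' → R i θ (G.outcome z) (G.outcome z')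

end Gradual

end GameForm

/-! ## Matching markets and top trading cycles

`N` is the set of agents and `A` the set of items. A preference ordering over items is a linear
order on `A` and the priority ordering of an item is a linear order on `N`; in both, GREATER means
better (more preferred, higher priority). -/

namespace TTC

open Classical in
/-- The best element of a finite set with respect to a linear order (`none` for the empty set). -/
noncomputable def best {α : Type*} (r : LinearOrder α) (s : Finset α) : Option α :=
  if hs : s.Nonempty then some (@Finset.max' α r s hs) else none

section Market

variable {N A : Type*} [Fintype N] [Fintype A]

open Classical in
/-- The agents remaining when the departed agents hold the items recorded in `asg`. -/
noncomputable def remAgents (asg : N → Option A) : Finset N :=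
  Finset.univ.filter fun i => asg i = none

open Classical in
/-- The items remaining when the departed agents hold the items recorded in `asg`. -/
noncomputable def remItems (asg : N → Option A) : Finset A :=
  Finset.univ.filter fun a => ∀ i, asg i ≠ some a

/-- The owner of item `a` in the sub-market: the remaining agent with the highest priority. -/
noncomputable def owner (prio : A → LinearOrder N) (asg : N → Option A) (a : A) : Option N :=
  best (prio a) (remAgents asg)

open Classical in
/-- The remaining items owned by agent `i`. -/
noncomputable def owned (prio : A → LinearOrder N) (asg : N → Option A) (i : N) : Finset A :=
  (remItems asg).filter fun a => owner prio asg a = some i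

open Classical in
/-- The owners of the sub-market. -/
noncomputable def owners (prio : A → LinearOrder N) (asg : N → Option A) : Finset N :=
  Finset.univ.filter fun i => (owned prio asg i).Nonempty

/-- `i` and `k` remain and `k` owns the most preferred remaining item of `i`. -/
def PointsTo (prio : A → LinearOrder N) (θ : N → LinearOrder A) (asg : N → Option A)
    (i k : N) : Prop :=
  i ∈ remAgents asg ∧ ∃ a, best (θ i) (remItems asg) = some a ∧ owner prio asg a = some k

open Classical in
/-- One stage of the top trading cycles algorithm: the members of the top trading cycles of the
sub-market leave with their most preferred remaining items. -/
noncomputable def stage (prio : A → LinearOrder N) (θ : N → LinearOrder A) (asg : N → Option A) :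
    N → Option A :=
  fun i => if Relation.TransGen (PointsTo prio θ asg) i i then best (θ i) (remItems asg)
    else asg i

/-- The social choice function generated by the top trading cycles algorithm. (Each stage clears
at least one agent, so `Fintype.card N` stages suffice; further stages change nothing.) -/
noncomputable def ttc (prio : A → LinearOrder N) (θ : N → LinearOrder A) : N → Option A :=
  (stage prio θ)^[Fintype.card N] fun _ => none

end Market

/-- The allocation `μ` is a matching of all agents with all items. -/
def IsMatching {N A : Type*} (μ : N → Option A) : Prop := ∃ e : N ≃ A, ∀ i, μ i = some (e i)

/-- Agent `i` of type `θ` weakly prefers the allocation `μ` to `μ'`: she only cares about her own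
item (and having an item is better than having none, which never matters for matchings). -/
def Prefers {N A : Type*} (i : N) (θ : LinearOrder A) (μ μ' : N → Option A) : Prop :=
  ∀ b, μ' i = some b → ∃ a, μ i = some a ∧ θ.le b a

end TTC

/-! ## The Renunciation-Designation-Assertion implementation -/

namespace RDA

open TTC

/-- The three sub-stages of a stage. -/
inductive SubStage where
  | renunciation
  | designation
  | assertion

/-- The answers that an agent may give. The answer `pass` is only used for the degenerate move at
the initial history of agents who own nothing. -/
inductive Answer (N A : Type*) where
  | pass
  | claim
  | renounce
  | designate (k : N)
  | take (a : A)

/-- The state of the procedure: the items with which agents have left; for each agent her latest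
designated trading partner, together with the items that the partner owned at that time; the
current sub-stage; and, in an assertion sub-stage, the menus of the agents who choose an item. -/
structure State (N A : Type*) where
  asg : N → Option A
  des : N → Option (N × Finset A)
  sub : SubStage
  menu : N → Option (Finset A)

/-- The initial state. -/
def State.init {N A : Type*} : State N A where
  asg := fun _ => none
  des := fun _ => none
  sub := .renunciation
  menu := fun _ => none

section Procedure

variable {N A : Type*} [Fintype N] [Fintype A] (prio : A → LinearOrder N)

/-- An owner is active at a stage unless she has designated a trading partner who still remains. -/
def IsActiveOwner (st : State N A) (i : N) : Prop :=
  i ∈ owners prio st.asg ∧ ∀ k C, st.des i = some (k, C) → st.asg k ≠ none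

open Classical in
/-- The question put to agent `i` in the state `st` (`none` if she is not asked): the function that
gives the truthful answer of each type.
* Renunciation: active owners tell whether they claim one of their own items (their favorite
  remaining item is their own) or renounce. At the initial history all other agents make a
  degenerate move.
* Designation: active owners designate the owner of their favorite remaining item.
* Assertion: agents with a menu choose their favorite item of the menu. -/
noncomputable def question (st : State N A) (i : N) : Option (LinearOrder A → Answer N A) :=
  match st.sub with
  | .renunciation =>
    if IsActiveOwner prio st i then
      some fun θ =>
        if ∃ a ∈ owned prio st.asg i, best θ (remItems st.asg) = some a then .claim else .renounce
    else if ∀ j, st.asg j = none then some fun _ => .pass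
    else none
  | .designation =>
    if IsActiveOwner prio st i then
      some fun θ =>
        ((best θ (remItems st.asg)).bind (owner prio st.asg)).elim .pass .designate
    else none
  | .assertion => (st.menu i).map fun C θ => (best θ C).elim .pass .take

/-- `i` and `k` remain and `k` is the designated trading partner of `i`. -/
def Designates (asg : N → Option A) (des : N → Option (N × Finset A)) (i k : N) : Prop :=
  asg i = none ∧ asg k = none ∧ ∃ C, des i = some (k, C)

/-- The record of designations after the answers `ans` of a designation sub-stage. -/
noncomputable def newDes (st : State N A) (ans : N → Answer N A) : N → Option (N × Finset A) :=
  fun i => match ans i with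
    | .designate k => some (k, owned prio st.asg k)
    | _ => st.des i

open Classical in
/-- The next state, given the answers.
* After a renunciation sub-stage: if some owners claim, the assertion sub-stage follows, in which
  exactly these owners choose, each among her own items; otherwise the designation sub-stage.
* After a designation sub-stage: the owners in a cycle of designations choose, each among the items
  that her trading partner owned when she designated him.
* After an assertion sub-stage: these agents leave with the chosen items; the next stage begins. -/
noncomputable def next (st : State N A) (ans : N → Answer N A) : State N A :=
  match st.sub with
  | .renunciation =>
    if ∃ i, ans i = .claim then
      { st with
        sub := .assertion
        menu := fun i => if ans i = .claim then some (owned prio st.asg i) else none }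
    else { st with sub := .designation }
  | .designation =>
    { st with
      des := newDes prio st ans
      sub := .assertion
      menu := fun i =>
        if Relation.TransGen (Designates st.asg (newDes prio st ans)) i i then
          (newDes prio st ans i).map Prod.snd
        else none }
  | .assertion =>
    { st with
      asg := fun i => match ans i with
        | .take a => some a
        | _ => st.asg i
      sub := .renunciation
      menu := fun _ => none }

/-- Histories of the gradual mechanism: actions are reported sets of types. -/
abbrev Hist (N A : Type*) := History fun _ : N => Set (LinearOrder A)

open Classical in
/-- The answer to the question `q` conveyed by the report `S` (a non-empty set of types which all
give the same answer). -/
noncomputable def answerOf (q : LinearOrder A → Answer N A) (S : Set (LinearOrder A)) :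
    Answer N A :=
  if hS : S.Nonempty then q hS.some else .pass

/-- The state reached after a history. -/
noncomputable def stateAt : Hist N A → State N A
  | [] => State.init
  | a :: h => next prio (stateAt h) fun i =>
      match question prio (stateAt h) i, a i with
      | some q, some S => answerOf q S
      | _, _ => .pass

/-- The histories of the mechanism: at each history exactly the agents who are asked a question
move, and the available reports of an agent are the non-empty sets of all types that are compatible
with her last report and give the same answer. -/
def IsHist : Hist N A → Prop
  | [] => True
  | a :: h => IsHist h ∧ (∃ i, (a i).isSome) ∧ ∀ i,
      match question prio (stateAt prio h) i with
      | none => a i = none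
      | some q => ∃ θ ∈ GameForm.lastReport i h,
          a i = some {θ' | θ' ∈ GameForm.lastReport i h ∧ q θ' = q θ}

/-- What an agent is told when she has to move: the sub-stage, the remaining owners, and the
remaining items. -/
noncomputable def observation (st : State N A) : SubStage × Finset N × Finset A :=
  (st.sub, owners prio st.asg, remItems st.asg)

/-- What agent `i` has been told and has reported so far (most recent first). -/
noncomputable def experience (i : N) :
    Hist N A → List ((SubStage × Finset N × Finset A) × Set (LinearOrder A))
  | [] => []
  | a :: h => match a i with
    | none => experience i h
    | some S => (observation prio (stateAt prio h), S) :: experience i h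

/-- The Renunciation-Designation-Assertion implementation for the priority structure `prio`. -/
noncomputable def mechanism : GameForm (fun _ : N => Set (LinearOrder A)) (N → Option A) where
  hist := {h | IsHist prio h}
  sameInfo := fun i h h' => experience prio i h = experience prio i h' ∧
    observation prio (stateAt prio h) = observation prio (stateAt prio h')
  outcome := fun z => (stateAt prio z).asg

end Procedure

end RDA

/-! Top trading cycles can be cleared in any order. Call a union of cycles of the pointing map a
trading set. Clearing one leaves every pointer between two stayers intact, so what is left of
another trading set can still be cleared, and both orders lead to clearing the union
(`Clears.diamond`). By Church–Rosser, two complete allocations reached by clearing trading sets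
coincide (`Reachable.eq_of_full`). As there are equally many agents and items, some cycle exists
while anybody remains, so TTC reaches a complete allocation.

For the mechanism, fix a type profile compatible with the reports. While a designated partner
remains, so do all items he owned when designated, still in his ownership; hence the designation is
still the truthful pointer and the recorded menu still contains the favorite remaining item. This is
the core of `Inv`. Consequently the agents with menus form a trading set, each assertion clears it,
and the final allocation is that of TTC (`outcome_eq_ttc`). Information sets are coherent because
the announced owners and items determine who owns what (`best_owners`), so that an agent's own last
move determines her menu (`determinedBy_experience`).

For incentives, compare a truthful play of agent `i` with a deviation. Until `i` receives a menu in
one of them, the states differ at most in the designation of `i`, so the others observe and do the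
same (`Coupled.step`). If the truthful play gives her a menu no later, she takes her favorite from a
set containing the item she would get by deviating. If the deviation gives her a menu first, a chain
of designations leads to `i` from the owner of the item `b` she takes. The chain uses no designation
by `i`, so it is also present in the truthful play; there its members cannot leave before `i`, and
`b` is still available when she chooses (`Secured.step`, `Secured.exists_le`). -/

namespace TTC

/-! ### Best elements of finite sets -/

section Best

variable {α : Type*}

theorem best_eq_some_iff (r : LinearOrder α) (s : Finset α) (a : α) :
    best r s = some a ↔ a ∈ s ∧ ∀ b ∈ s, r.le b a := by
  unfold best
  split_ifs with hs
  · rw [Option.some_inj]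
    constructor
    · rintro rfl
      exact ⟨@Finset.max'_mem α r s hs, fun b hb => @Finset.le_max' α r s b hb⟩
    · rintro ⟨ha, hle⟩
      exact r.le_antisymm _ _ (hle _ (@Finset.max'_mem α r s hs)) (@Finset.le_max' α r s a ha)
  · simp only [false_iff]
    rintro ⟨ha, -⟩
    exact hs ⟨a, ha⟩

theorem exists_best (r : LinearOrder α) {s : Finset α} (hs : s.Nonempty) :
    ∃ a, best r s = some a := by
  simp [best, hs]

theorem best_of_subset {r : LinearOrder α} {s t : Finset α} {a : α} (h : best r t = some a)
    (hst : s ⊆ t) (ha : a ∈ s) : best r s = some a := by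
  rw [best_eq_some_iff] at h ⊢
  exact ⟨ha, fun b hb => h.2 b (hst hb)⟩

end Best

/-! ### Cycles and paths of relations -/

section Relations

open Relation

variable {α : Type*}

/-- Without a cycle the transitive closure is a strict order on a finite type, hence well-founded;
an extremal element of `v` would have no successor in `v`. -/
theorem exists_transGen_self [Finite α] {r : α → α → Prop} {v : Set α} (hv : v.Nonempty)
    (h : ∀ i ∈ v, ∃ k ∈ v, r i k) : ∃ i, TransGen r i i := by
  by_contra! hirr
  let q : α → α → Prop := fun a b => TransGen r b a
  have : IsTrans α q := ⟨fun _ _ _ h₁ h₂ => TransGen.trans h₂ h₁⟩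
  have : Std.Irrefl q := ⟨hirr⟩
  have wf : WellFounded q := Finite.wellFounded_of_trans_of_irrefl q
  obtain ⟨m, hm, hmin⟩ := wf.has_min v hv
  obtain ⟨k, hk, hmk⟩ := h m hm
  exact hmin k hk (TransGen.single hmk)

/-- In a functional relation, whatever is reachable from a point on a cycle leads back to it. -/
theorem reflTransGen_back {r : α → α → Prop} (hr : ∀ i k k', r i k → r i k' → k = k') {i x : α}
    (hi : TransGen r i i) (hx : ReflTransGen r i x) : ReflTransGen r x i := by
  induction hx with
  | refl => exact .refl
  | tail _ hbc ih =>
    rcases ih.cases_head with h | ⟨d, hbd, hd⟩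
    · subst h
      obtain ⟨d, hd, hdi⟩ := (TransGen.head'_iff).1 hi
      rwa [hr _ _ _ hbc hd]
    · rwa [hr _ _ _ hbc hbd]

theorem transGen_congr {r r' : α → α → Prop} {i j : α}
    (h : ∀ x y, ReflTransGen r i x → r x y → r' x y) (hij : TransGen r i j) :
    TransGen r' i j := by
  induction hij with
  | single hb => exact .single (h _ _ .refl hb)
  | tail hab hbc ih => exact ih.tail (h _ _ hab.to_reflTransGen hbc)

/-- A path ending in `i` can be chosen not to pass through `i` before its end. -/
theorem reflTransGen_congr_of_ne {r r' : α → α → Prop} {i k : α}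
    (h : ∀ x y, x ≠ i → r x y → r' x y) (hk : ReflTransGen r k i) : ReflTransGen r' k i := by
  induction hk using ReflTransGen.head_induction_on with
  | refl => exact .refl
  | @head x y hxy _ ih =>
    by_cases hx : x = i
    · subst hx; exact .refl
    · exact ih.head (h _ _ hx hxy)

end Relations

/-! ### Sub-markets, owners and pointers -/

section Market

set_option linter.unusedSectionVars false

open Relation

variable {N A : Type*} [Fintype N] [Fintype A] {prio : A → LinearOrder N}
  {θ : N → LinearOrder A} {asg : N → Option A}

theorem mem_remAgents {i : N} : i ∈ remAgents asg ↔ asg i = none := by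
  simp [remAgents]

theorem mem_remItems {a : A} : a ∈ remItems asg ↔ ∀ i, asg i ≠ some a := by
  simp [remItems]

theorem mem_owned {i : N} {a : A} :
    a ∈ owned prio asg i ↔ a ∈ remItems asg ∧ owner prio asg a = some i := by
  simp [owned]

theorem mem_owners {i : N} :
    i ∈ owners prio asg ↔ ∃ a ∈ remItems asg, owner prio asg a = some i := by
  rw [owners, Finset.mem_filter]
  simp [Finset.Nonempty, mem_owned]

theorem asg_eq_none_of_owner {a : A} {i : N} (h : owner prio asg a = some i) : asg i = none :=
  mem_remAgents.1 ((best_eq_some_iff _ _ _).1 h).1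

theorem exists_owner (a : A) {i : N} (hi : asg i = none) : ∃ k, owner prio asg a = some k :=
  exists_best _ ⟨i, mem_remAgents.2 hi⟩

theorem asg_eq_none_of_mem_owners {i : N} (h : i ∈ owners prio asg) : asg i = none := by
  obtain ⟨a, -, ha⟩ := mem_owners.1 h
  exact asg_eq_none_of_owner ha

theorem mem_of_best {α : Type*} {r : LinearOrder α} {s : Finset α} {a : α}
    (h : best r s = some a) : a ∈ s :=
  ((best_eq_some_iff _ _ _).1 h).1

theorem PointsTo.unique {i k k' : N} (h : PointsTo prio θ asg i k)
    (h' : PointsTo prio θ asg i k') : k = k' := by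
  obtain ⟨-, a, ha, hk⟩ := h
  obtain ⟨-, a', ha', hk'⟩ := h'
  obtain rfl : a = a' := Option.some_inj.1 (ha.symm.trans ha')
  exact Option.some_inj.1 (hk.symm.trans hk')

theorem PointsTo.mem_owners {i k : N} (h : PointsTo prio θ asg i k) : k ∈ owners prio asg := by
  obtain ⟨-, a, ha, hk⟩ := h
  exact TTC.mem_owners.2 ⟨a, mem_of_best ha, hk⟩

theorem exists_pointsTo {i : N} (hi : asg i = none) (hA : (remItems asg).Nonempty) :
    ∃ k, PointsTo prio θ asg i k := by
  obtain ⟨a, ha⟩ := exists_best (θ i) hA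
  obtain ⟨k, hk⟩ := exists_owner (prio := prio) a hi
  exact ⟨k, mem_remAgents.2 hi, a, ha, hk⟩

/-! ### Clearing unions of top trading cycles -/

variable (prio θ asg) in
/-- `S` is a union of top trading cycles. -/
def IsTradingSet (S : Set N) : Prop :=
  ∀ i ∈ S, TransGen (PointsTo prio θ asg) i i ∧ ∀ k, PointsTo prio θ asg i k → k ∈ S

open Classical in
variable (θ asg) in
/-- The members of `S` leave with their most preferred remaining items. -/
noncomputable def clear (S : Set N) : N → Option A :=
  fun i => if i ∈ S then best (θ i) (remItems asg) else asg i

namespace IsTradingSet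

variable {S T : Set N}

theorem exists_item (hS : IsTradingSet prio θ asg S) {i : N} (hi : i ∈ S) :
    asg i = none ∧ ∃ a k, best (θ i) (remItems asg) = some a ∧ owner prio asg a = some k ∧ k ∈ S ∧
      PointsTo prio θ asg i k := by
  obtain ⟨hc, hS'⟩ := hS i hi
  obtain ⟨k, hk, -⟩ := TransGen.head'_iff.1 hc
  obtain ⟨hi', a, ha, hka⟩ := id hk
  exact ⟨mem_remAgents.1 hi', a, k, ha, hka, hS' k hk, hk⟩

theorem clear_eq_none_iff (hS : IsTradingSet prio θ asg S) {i : N} :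
    clear θ asg S i = none ↔ i ∉ S ∧ asg i = none := by
  unfold clear
  split_ifs with hi
  · obtain ⟨-, a, -, ha, -⟩ := hS.exists_item hi
    simp [ha, hi]
  · simp [hi]

theorem clear_of_eq_some (hS : IsTradingSet prio θ asg S) {i : N} {a : A} (h : asg i = some a) :
    clear θ asg S i = some a := by
  unfold clear
  split_ifs with hi
  · simp [(hS.exists_item hi).1] at h
  · exact h

theorem remItems_clear_subset (hS : IsTradingSet prio θ asg S) :
    remItems (clear θ asg S) ⊆ remItems asg := by
  intro a ha
  rw [mem_remItems] at ha ⊢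
  exact fun i hi => ha i (hS.clear_of_eq_some hi)

theorem remAgents_clear_subset (hS : IsTradingSet prio θ asg S) :
    remAgents (clear θ asg S) ⊆ remAgents asg := by
  intro i hi
  rw [mem_remAgents] at hi ⊢
  exact (hS.clear_eq_none_iff.1 hi).2

theorem owner_clear (hS : IsTradingSet prio θ asg S) {a : A} {k : N} (hk : k ∉ S)
    (ho : owner prio asg a = some k) : owner prio (clear θ asg S) a = some k :=
  best_of_subset ho hS.remAgents_clear_subset
    (mem_remAgents.2 (hS.clear_eq_none_iff.2 ⟨hk, asg_eq_none_of_owner ho⟩))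

/-- An item leaves only with an agent pointing to its owner, and `S` is closed under pointing, so
the owner would leave too. -/
theorem mem_remItems_clear (hS : IsTradingSet prio θ asg S) {a : A} {k : N} (hk : k ∉ S)
    (ho : owner prio asg a = some k) (ha : a ∈ remItems asg) : a ∈ remItems (clear θ asg S) := by
  rw [mem_remItems] at ha ⊢
  intro i hi
  unfold clear at hi
  split_ifs at hi with hiS
  · obtain ⟨-, b, k', hb, hk', hkS, -⟩ := hS.exists_item hiS
    obtain rfl : b = a := Option.some_inj.1 (hb.symm.trans hi)
    exact hk (Option.some_inj.1 (ho.symm.trans hk') ▸ hkS)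
  · exact ha i hi

theorem best_clear (hS : IsTradingSet prio θ asg S) {r : LinearOrder A} {a : A} {k : N}
    (hk : k ∉ S) (ho : owner prio asg a = some k) (ha : best r (remItems asg) = some a) :
    best r (remItems (clear θ asg S)) = some a :=
  best_of_subset ha hS.remItems_clear_subset (hS.mem_remItems_clear hk ho (mem_of_best ha))

theorem pointsTo_clear (hS : IsTradingSet prio θ asg S) {i k : N} (hi : i ∉ S) (hk : k ∉ S)
    (h : PointsTo prio θ asg i k) : PointsTo prio θ (clear θ asg S) i k := by
  obtain ⟨hi', a, ha, ho⟩ := h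
  exact ⟨mem_remAgents.2 (hS.clear_eq_none_iff.2 ⟨hi, mem_remAgents.1 hi'⟩), a,
    hS.best_clear hk ho ha, hS.owner_clear hk ho⟩

theorem mem_of_reflTransGen (hS : IsTradingSet prio θ asg S) {i x : N} (hi : i ∈ S)
    (hx : ReflTransGen (PointsTo prio θ asg) i x) : x ∈ S := by
  induction hx with
  | refl => exact hi
  | tail _ hbc ih => exact (hS _ ih).2 _ hbc

/-- The path from `i` stays on the cycle of `i`, so from a point of `S` it would lead back to `i`,
forcing `i ∈ S`. -/
theorem not_mem_of_reflTransGen (hS : IsTradingSet prio θ asg S)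
    (hT : IsTradingSet prio θ asg T) {i x : N} (hi : i ∈ T \ S)
    (hx : ReflTransGen (PointsTo prio θ asg) i x) : x ∉ S := fun hxS =>
  hi.2 (hS.mem_of_reflTransGen hxS
    (reflTransGen_back (fun _ _ _ h h' => h.unique h') (hT i hi.1).1 hx))

theorem sdiff (hS : IsTradingSet prio θ asg S) (hT : IsTradingSet prio θ asg T) :
    IsTradingSet prio θ (clear θ asg S) (T \ S) := by
  intro i hi
  constructor
  · refine transGen_congr (fun x y hx hxy => hS.pointsTo_clear ?_ ?_ hxy) (hT i hi.1).1
    · exact hS.not_mem_of_reflTransGen hT hi hx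
    · exact hS.not_mem_of_reflTransGen hT hi (hx.tail hxy)
  · intro k hk
    obtain ⟨-, a, k', ha, hk', hkT, hik⟩ := hT.exists_item hi.1
    have hkS := hS.not_mem_of_reflTransGen hT hi (.single hik)
    obtain rfl := hk.unique (hS.pointsTo_clear hi.2 hkS hik)
    exact ⟨hkT, hkS⟩

open Classical in
theorem clear_clear (hS : IsTradingSet prio θ asg S) (hT : IsTradingSet prio θ asg T) :
    clear θ (clear θ asg S) (T \ S) = clear θ asg (S ∪ T) := by
  funext i
  by_cases hiS : i ∈ S
  · simp [clear, hiS]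
  by_cases hiT : i ∈ T
  · obtain ⟨-, a, k, ha, hk, hkT, hik⟩ := hT.exists_item hiT
    have hkS := hS.not_mem_of_reflTransGen hT ⟨hiT, hiS⟩ (.single hik)
    have hb := hS.best_clear hkS hk ha
    simp [clear, hiS, hiT] at hb ⊢
    rw [hb, ha]
  · simp [clear, hiS, hiT]

/-- Different members of a union of top trading cycles leave with different items. -/
theorem best_injOn (hS : IsTradingSet prio θ asg S) {i j : N} (hi : i ∈ S) (hj : j ∈ S)
    (hij : best (θ i) (remItems asg) = best (θ j) (remItems asg)) : i = j := by
  choose hn a k ha hk hkS hik using fun x : S => hS.exists_item x.2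
  -- Every agent of `S` has a predecessor on her cycle, so pointing is a surjection of the finite
  -- set `S`, hence injective; equal items have equal owners.
  let f : S → S := fun x => ⟨k x, hkS x⟩
  have hf : Function.Surjective f := by
    rintro ⟨y, hy⟩
    obtain ⟨x, hyx, hxy⟩ := TransGen.tail'_iff.1 (hS y hy).1
    have hx := hS.mem_of_reflTransGen hy hyx
    exact ⟨⟨x, hx⟩, Subtype.ext ((hik ⟨x, hx⟩).unique hxy)⟩
  have hinj : Function.Injective f := Finite.injective_iff_surjective.2 hf
  have hab : a ⟨i, hi⟩ = a ⟨j, hj⟩ := by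
    have h := hij
    rw [ha ⟨i, hi⟩, ha ⟨j, hj⟩] at h
    exact Option.some_inj.1 h
  have : f ⟨i, hi⟩ = f ⟨j, hj⟩ := by
    refine Subtype.ext (Option.some_inj.1 ?_)
    rw [← hk, ← hk, hab]
  exact congrArg Subtype.val (hinj this)

end IsTradingSet

/-! ### Independence of the order of clearing -/

variable (prio θ) in
/-- Some top trading cycles are cleared. -/
def Clears (asg asg' : N → Option A) : Prop :=
  ∃ S, IsTradingSet prio θ asg S ∧ asg' = clear θ asg S

theorem Clears.diamond {asg' asg'' : N → Option A} (h' : Clears prio θ asg asg')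
    (h'' : Clears prio θ asg asg'') : ∃ d, Clears prio θ asg' d ∧ Clears prio θ asg'' d := by
  obtain ⟨S, hS, rfl⟩ := h'
  obtain ⟨T, hT, rfl⟩ := h''
  refine ⟨clear θ asg (S ∪ T), ⟨T \ S, hS.sdiff hT, (hS.clear_clear hT).symm⟩,
    ⟨S \ T, hT.sdiff hS, ?_⟩⟩
  rw [hT.clear_clear hS, Set.union_comm]

theorem Clears.eq_of_full {asg' : N → Option A} (h : Clears prio θ asg asg')
    (hfull : ∀ i, asg i ≠ none) : asg' = asg := by
  obtain ⟨S, hS, rfl⟩ := h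
  funext i
  have : i ∉ S := fun hi => hfull i (hS.exists_item hi).1
  simp [clear, this]

variable (prio θ) in
/-- The allocation `asg` is reached from the empty one by clearing top trading cycles. -/
def Reachable (asg : N → Option A) : Prop :=
  ReflTransGen (Clears prio θ) (fun _ => none) asg

theorem reflTransGen_eq_of_full {asg' : N → Option A}
    (h : ReflTransGen (Clears prio θ) asg asg') (hfull : ∀ i, asg i ≠ none) : asg' = asg := by
  induction h with
  | refl => rfl
  | tail _ hbc ih => subst ih; exact hbc.eq_of_full hfull

/-- The diamond property yields a common allocation reachable from both, and clearing cannot change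
a full allocation. -/
theorem Reachable.eq_of_full {asg' : N → Option A} (h : Reachable prio θ asg)
    (h' : Reachable prio θ asg') (hfull : ∀ i, asg i ≠ none) (hfull' : ∀ i, asg' i ≠ none) :
    asg = asg' := by
  obtain ⟨d, hd, hd'⟩ := church_rosser (fun a b c hab hac => by
    obtain ⟨d, hb, hc⟩ := Clears.diamond hab hac
    exact ⟨d, .single hb, .single hc⟩) h h'
  rw [← reflTransGen_eq_of_full hd hfull, reflTransGen_eq_of_full hd' hfull']

theorem Reachable.injective (h : Reachable prio θ asg) {i j : N} {a : A}
    (hi : asg i = some a) (hj : asg j = some a) : i = j := by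
  induction h generalizing i j a with
  | refl => simp at hi
  | @tail b _ _ hbc ih =>
    obtain ⟨S, hS, rfl⟩ := hbc
    have key : ∀ {x y : N}, x ∈ S → y ∉ S → clear θ b S x = some a → clear θ b S y = some a →
        False := by
      intro x y hx hy hxa hya
      simp only [clear, if_pos hx, if_neg hy] at hxa hya
      exact mem_remItems.1 (mem_of_best hxa) y hya
    by_cases hiS : i ∈ S <;> by_cases hjS : j ∈ S
    · simp only [clear, if_pos hiS, if_pos hjS] at hi hj
      exact hS.best_injOn hiS hjS (hi.trans hj.symm)
    · exact (key hiS hjS hi hj).elim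
    · exact (key hjS hiS hj hi).elim
    · simp only [clear, if_neg hiS, if_neg hjS] at hi hj
      exact ih hi hj

/-! ### Completeness of the TTC allocation -/

theorem remItems_nonempty
    (hcard : Fintype.card N = Fintype.card A) {i : N} (hi : asg i = none) :
    (remItems asg).Nonempty := by
  by_contra hne
  have hall : ∀ a, ∃ j, asg j = some a := by
    intro a
    by_contra! hc
    exact hne ⟨a, mem_remItems.2 hc⟩
  choose f hf using hall
  -- Choosing a holder for each item is injective, hence by counting surjective, so `i` would hold
  -- an item.
  have hinj : Function.Injective f := fun a b hab =>
    Option.some_inj.1 ((hf a).symm.trans (hab ▸ hf b))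
  obtain ⟨a, ha⟩ := ((Fintype.bijective_iff_injective_and_card f).2 ⟨hinj, hcard.symm⟩).2 i
  simp [← ha, hf] at hi

theorem Reachable.isMatching (h : Reachable prio θ asg)
    (hcard : Fintype.card N = Fintype.card A) (hfull : ∀ i, asg i ≠ none) : IsMatching asg := by
  choose f hf using fun i => Option.ne_none_iff_exists'.1 (hfull i)
  have hinj : Function.Injective f := fun i j hij => h.injective (hf i) (hij ▸ hf j)
  exact ⟨Equiv.ofBijective f ((Fintype.bijective_iff_injective_and_card f).2 ⟨hinj, hcard⟩), hf⟩

theorem clears_stage : Clears prio θ asg (stage prio θ asg) := by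
  refine ⟨{i | TransGen (PointsTo prio θ asg) i i}, fun i hi => ⟨hi, fun k hk => ?_⟩, rfl⟩
  exact .tail' (reflTransGen_back (fun _ _ _ h h' => h.unique h') hi (.single hk)) hk

theorem reachable_iterate_stage (n : ℕ) :
    Reachable prio θ ((stage prio θ)^[n] fun _ => none) := by
  induction n with
  | zero => exact .refl
  | succ n ih => rw [Function.iterate_succ_apply']; exact ih.tail clears_stage

theorem IsTradingSet.card_remAgents_clear_lt {S : Set N} (hS : IsTradingSet prio θ asg S)
    (hne : S.Nonempty) : (remAgents (clear θ asg S)).card < (remAgents asg).card := by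
  obtain ⟨i, hi⟩ := hne
  refine Finset.card_lt_card ⟨hS.remAgents_clear_subset, fun h => ?_⟩
  exact (hS.clear_eq_none_iff.1 (mem_remAgents.1
    (h (mem_remAgents.2 (hS.exists_item hi).1)))).1 hi

theorem exists_cycle
    (hcard : Fintype.card N = Fintype.card A) {i : N} (hi : asg i = none) :
    ∃ j, TransGen (PointsTo prio θ asg) j j := by
  refine exists_transGen_self (v := {j | asg j = none}) ⟨i, hi⟩ fun j hj => ?_
  obtain ⟨k, hk⟩ := exists_pointsTo (prio := prio) (θ := θ) hj (remItems_nonempty hcard hi)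
  obtain ⟨-, a, -, ha⟩ := id hk
  exact ⟨k, asg_eq_none_of_owner ha, hk⟩

theorem card_remAgents_iterate_stage (hcard : Fintype.card N = Fintype.card A) (n : ℕ) :
    (remAgents ((stage prio θ)^[n] fun _ => none)).card ≤ Fintype.card N - n := by
  induction n with
  | zero => exact Finset.card_le_univ _
  | succ n ih =>
    rw [Function.iterate_succ_apply']
    obtain ⟨S, hS, hSe⟩ := clears_stage (prio := prio) (θ := θ)
      (asg := (stage prio θ)^[n] fun _ => none)
    rcases (remAgents ((stage prio θ)^[n] fun _ => none)).eq_empty_or_nonempty with he | ⟨i, hi⟩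
    · rw [hSe]
      have := Finset.card_le_card hS.remAgents_clear_subset
      rw [he] at this
      simp only [Finset.card_empty] at this
      omega
    · obtain ⟨j, hj⟩ := exists_cycle (prio := prio) (θ := θ) hcard (mem_remAgents.1 hi)
      have hlt : (remAgents (stage prio θ ((stage prio θ)^[n] fun _ => none))).card <
          (remAgents ((stage prio θ)^[n] fun _ => none)).card := by
        refine IsTradingSet.card_remAgents_clear_lt (prio := prio) (θ := θ)
          (S := {i | TransGen (PointsTo prio θ _) i i}) ?_ ⟨j, hj⟩
        refine fun i hi => ⟨hi, fun k hk => ?_⟩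
        exact .tail' (reflTransGen_back (fun _ _ _ h h' => h.unique h') hi (.single hk)) hk
      omega

theorem reachable_ttc : Reachable prio θ (ttc prio θ) := reachable_iterate_stage _

theorem ttc_ne_none (hcard : Fintype.card N = Fintype.card A) (i : N) : ttc prio θ i ≠ none := by
  intro hi
  have h := card_remAgents_iterate_stage (prio := prio) (θ := θ) hcard (Fintype.card N)
  simp only [Nat.sub_self, Nat.le_zero_eq, Finset.card_eq_zero] at h
  have := mem_remAgents.2 hi
  simp [ttc, h] at this

theorem isMatching_ttc (hcard : Fintype.card N = Fintype.card A) : IsMatching (ttc prio θ) :=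
  reachable_ttc.isMatching hcard (ttc_ne_none hcard)

end Market

end TTC

namespace RDA

open TTC Relation

/-! ### The procedure under truthful answers -/

section Truthful

set_option linter.unusedSectionVars false

variable {N A : Type*} [Fintype N] [Fintype A] {prio : A → LinearOrder N}
  {θ : N → LinearOrder A} {st : State N A}

variable (prio θ) in
/-- The truthful answers of the type profile `θ`. -/
noncomputable def truthful (st : State N A) (i : N) : Answer N A :=
  (question prio st i).elim .pass fun q => q (θ i)

variable (prio θ) in
/-- The next state under truthful answers of the type profile `θ`. -/
noncomputable def step (st : State N A) : State N A := next prio st (truthful prio θ st)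

theorem truthful_eq_claim_iff (hs : st.sub = .renunciation) {i : N} :
    truthful prio θ st i = .claim ↔ IsActiveOwner prio st i ∧
      ∃ a ∈ owned prio st.asg i, best (θ i) (remItems st.asg) = some a := by
  unfold truthful question
  rw [hs]
  by_cases h : IsActiveOwner prio st i
  · by_cases h' : ∃ a ∈ owned prio st.asg i, best (θ i) (remItems st.asg) = some a <;> simp [h, h']
  · by_cases h' : ∀ j, st.asg j = none <;> simp [h, h']

theorem truthful_designation (hs : st.sub = .designation) {i : N}
    (h : IsActiveOwner prio st i) :
    ∃ a k, best (θ i) (remItems st.asg) = some a ∧ owner prio st.asg a = some k ∧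
      truthful prio θ st i = .designate k := by
  obtain ⟨b, hb, hbi⟩ := mem_owners.1 h.1
  obtain ⟨a, ha⟩ := exists_best (θ i) ⟨b, hb⟩
  obtain ⟨k, hk⟩ := exists_owner (prio := prio) a (asg_eq_none_of_owner hbi)
  refine ⟨a, k, ha, hk, ?_⟩
  simp [truthful, question, hs, h, ha, hk]

theorem truthful_designation_of_not (hs : st.sub = .designation) {i : N}
    (h : ¬ IsActiveOwner prio st i) : truthful prio θ st i = .pass := by
  simp [truthful, question, hs, h]

theorem truthful_assertion (hs : st.sub = .assertion) {i : N} {C : Finset A} {a : A}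
    (hC : st.menu i = some C) (ha : best (θ i) C = some a) :
    truthful prio θ st i = .take a := by
  simp [truthful, question, hs, hC, ha]

theorem truthful_assertion_of_none (hs : st.sub = .assertion) {i : N}
    (hC : st.menu i = none) : truthful prio θ st i = .pass := by
  simp [truthful, question, hs, hC]

theorem owners_nonempty (hcard : Fintype.card N = Fintype.card A) {asg : N → Option A} {i : N}
    (hi : asg i = none) : (owners prio asg).Nonempty := by
  obtain ⟨a, ha⟩ := remItems_nonempty hcard hi
  obtain ⟨k, hk⟩ := exists_owner (prio := prio) a hi
  exact ⟨k, mem_owners.2 ⟨a, ha, hk⟩⟩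

variable (prio θ) in
/-- What is known about the states that are reached when the type profile is `θ`. -/
structure Inv (st : State N A) : Prop where
  reachable : Reachable prio θ st.asg
  -- The recorded set `C` may be smaller than what `k` owns now, since `k` can inherit items, but it
  -- still contains the favorite remaining item of `i`.
  des : ∀ i k C, st.des i = some (k, C) → st.asg i = none → st.asg k = none →
    ∃ a, best (θ i) (remItems st.asg) = some a ∧ owner prio st.asg a = some k ∧
      best (θ i) C = some a ∧ ∀ b ∈ C, b ∈ remItems st.asg ∧ owner prio st.asg b = some k
  -- Outside assertion sub-stages there are no menus, so this excludes cycles of designations there.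
  cycle : ∀ i, TransGen (Designates st.asg st.des) i i → st.menu i ≠ none
  menu : ∀ i C, st.menu i = some C →
    ∃ a k, best (θ i) (remItems st.asg) = some a ∧ owner prio st.asg a = some k ∧
      st.asg i = none ∧ best (θ i) C = some a ∧ st.menu k ≠ none ∧
      (∀ b ∈ C, b ∈ remItems st.asg ∧ owner prio st.asg b = some k) ∧
      ReflTransGen (Designates st.asg st.des) k i
  menu_eq_none : st.sub ≠ .assertion → ∀ i, st.menu i = none
  exists_menu : st.sub = .assertion → ∃ i, st.menu i ≠ none
  exists_rem : st.sub = .designation → ∃ i, st.asg i = none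
  -- This keeps the degenerate question `pass` away from agents with a standing designation.
  des_eq_none : st.sub = .renunciation → (∀ j, st.asg j = none) → ∀ i, st.des i = none

theorem Inv.init : Inv prio θ State.init where
  reachable := .refl
  des := by simp [State.init]
  cycle := by
    intro i hi
    obtain ⟨k, ⟨-, -, C, hC⟩, -⟩ := TransGen.head'_iff.1 hi
    simp [State.init] at hC
  menu := by simp [State.init]
  menu_eq_none := by simp [State.init]
  exists_menu := by simp [State.init]
  exists_rem := by simp [State.init]
  des_eq_none := by simp [State.init]

theorem Inv.pointsTo (h : Inv prio θ st) {i k : N} (hik : Designates st.asg st.des i k) :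
    PointsTo prio θ st.asg i k := by
  obtain ⟨hi, hk, C, hC⟩ := hik
  obtain ⟨a, ha, hak, -⟩ := h.des i k C hC hi hk
  exact ⟨mem_remAgents.2 hi, a, ha, hak⟩

/-- Designations are truthful pointers, so the recorded chain back to `i`, preceded by the pointer
of `i`, is a top trading cycle. -/
theorem Inv.isTradingSet (h : Inv prio θ st) :
    IsTradingSet prio θ st.asg {i | st.menu i ≠ none} := by
  intro i hi
  obtain ⟨C, hC⟩ := Option.ne_none_iff_exists'.1 hi
  obtain ⟨a, k, ha, hak, hi', -, hk, -, hki⟩ := h.menu i C hC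
  have hik : PointsTo prio θ st.asg i k := ⟨mem_remAgents.2 hi', a, ha, hak⟩
  refine ⟨.head' hik (ReflTransGen.mono (fun _ _ => h.pointsTo) _ _ hki), fun k' hk' => ?_⟩
  rwa [← hik.unique hk']

theorem Inv.menu_ne_none_of_designates (h : Inv prio θ st) {i k : N}
    (hik : Designates st.asg st.des i k) (hi : st.menu i ≠ none) : st.menu k ≠ none :=
  (h.isTradingSet i hi).2 k (h.pointsTo hik)

/-- If every owner waited for a remaining partner, who is again an owner, designations would form a
cycle, which `Inv.cycle` excludes here. -/
theorem Inv.exists_active (hcard : Fintype.card N = Fintype.card A) (h : Inv prio θ st)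
    (hs : st.sub ≠ .assertion) {i : N} (hi : st.asg i = none) :
    ∃ j, IsActiveOwner prio st j := by
  by_contra! hno
  obtain ⟨j, hj⟩ := exists_transGen_self (r := Designates st.asg st.des)
    (v := {j | j ∈ owners prio st.asg}) (owners_nonempty hcard hi) (by
      intro j hj
      have := hno j
      simp only [IsActiveOwner, not_and, not_forall, not_not] at this
      obtain ⟨k, C, hkC, hk⟩ := this hj
      have hd : Designates st.asg st.des j k := ⟨asg_eq_none_of_mem_owners hj, hk, C, hkC⟩
      exact ⟨k, (h.pointsTo hd).mem_owners, hd⟩)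
  exact h.cycle j hj (h.menu_eq_none hs j)

theorem step_renunciation_claim (hs : st.sub = .renunciation) {i : N}
    (hi : truthful prio θ st i = .claim) : (step prio θ st).asg = st.asg ∧
      (step prio θ st).des = st.des ∧ (step prio θ st).sub = .assertion ∧
      ∀ j C, (step prio θ st).menu j = some C ↔
        truthful prio θ st j = .claim ∧ C = owned prio st.asg j := by
  have he : ∃ i, truthful prio θ st i = .claim := ⟨i, hi⟩
  unfold step next
  rw [hs]
  simp only [he, if_true]
  refine ⟨trivial, trivial, trivial, fun j C => ?_⟩
  split_ifs with hj
  · simp [hj, eq_comm]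
  · simp [hj]

theorem step_renunciation (hs : st.sub = .renunciation)
    (hi : ∀ i, truthful prio θ st i ≠ .claim) :
    step prio θ st = { st with sub := .designation } := by
  have he : ¬ ∃ i, truthful prio θ st i = .claim := by simpa using hi
  unfold step next
  rw [hs]
  simp only [he, if_false]

theorem step_designation (hs : st.sub = .designation) :
    (step prio θ st).asg = st.asg ∧ (step prio θ st).sub = .assertion ∧
      (∀ i, IsActiveOwner prio st i → ∃ a k, best (θ i) (remItems st.asg) = some a ∧
        owner prio st.asg a = some k ∧ truthful prio θ st i = .designate k ∧
        (step prio θ st).des i = some (k, owned prio st.asg k)) ∧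
      (∀ i, ¬ IsActiveOwner prio st i → (step prio θ st).des i = st.des i) ∧
      ∀ i C, (step prio θ st).menu i = some C ↔
        TransGen (Designates st.asg (step prio θ st).des) i i ∧
          ∃ k, (step prio θ st).des i = some (k, C) := by
  have hd : (step prio θ st).des = newDes prio st (truthful prio θ st) := by
    simp [step, next, hs]
  refine ⟨by simp [step, next, hs], by simp [step, next, hs], fun i hi => ?_, fun i hi => ?_,
    fun i C => ?_⟩
  · obtain ⟨a, k, ha, hk, hans⟩ := truthful_designation (θ := θ) hs hi
    exact ⟨a, k, ha, hk, hans, by rw [hd]; simp [newDes, hans]⟩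
  · rw [hd]; simp [newDes, truthful_designation_of_not hs hi]
  · rw [hd]
    simp only [step, next, hs]
    split_ifs with hc <;> simp [hc]

/-- The favorite item of the menu is the favorite remaining item, so an assertion is one clearing of
a trading set. -/
theorem Inv.step_assertion (h : Inv prio θ st) (hs : st.sub = .assertion) :
    step prio θ st = { asg := clear θ st.asg {i | st.menu i ≠ none}
                       des := st.des
                       sub := .renunciation
                       menu := fun _ => none } := by
  simp only [step, next, hs, State.mk.injEq, and_true]
  funext i
  rcases hm : st.menu i with _ | C
  · simp [truthful_assertion_of_none hs hm, clear, hm]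
  · obtain ⟨a, k, ha, -, -, hC, -⟩ := h.menu i C hm
    simp [truthful_assertion hs hm hC, clear, hm, ha]

theorem Inv.step (hcard : Fintype.card N = Fintype.card A) (h : Inv prio θ st)
    (hq : ∃ i, st.asg i = none) : Inv prio θ (step prio θ st) := by
  rcases hs : st.sub
  · by_cases hc : ∃ i, truthful prio θ st i = .claim
    · obtain ⟨i₀, hi₀⟩ := hc
      obtain ⟨h1, h2, h3, h4⟩ := step_renunciation_claim hs hi₀
      have hm : ∀ i, st.menu i = none := h.menu_eq_none (by simp [hs])
      have hmenu : ∀ j, truthful prio θ st j = .claim → (RDA.step prio θ st).menu j ≠ none := by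
        intro j hj
        rw [(h4 j _).2 ⟨hj, rfl⟩]
        simp
      refine ⟨h1 ▸ h.reachable, ?_, ?_, ?_, by simp [h3], fun _ => ⟨i₀, hmenu i₀ hi₀⟩,
        by simp [h3], by simp [h3]⟩
      · rw [h1, h2]; exact h.des
      · rw [h1, h2]; exact fun i hi => (h.cycle i hi (hm i)).elim
      · intro i C hiC
        obtain ⟨hcl, rfl⟩ := (h4 i C).1 hiC
        obtain ⟨-, a, hao, ha⟩ := (truthful_eq_claim_iff hs).1 hcl
        have hoi := (mem_owned.1 hao).2
        rw [h1, h2]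
        exact ⟨a, i, ha, hoi, asg_eq_none_of_owner hoi,
          best_of_subset ha (fun b hb => (mem_owned.1 hb).1) hao, hmenu i hcl,
          fun b hb => mem_owned.1 hb, .refl⟩
    · push Not at hc
      rw [step_renunciation hs hc]
      exact ⟨h.reachable, h.des, h.cycle, h.menu, fun _ => h.menu_eq_none (by simp [hs]),
        by simp, fun _ => hq, by simp⟩
  · obtain ⟨h1, h2, h3, h4, h5⟩ := step_designation (prio := prio) (θ := θ) hs
    have hdes : ∀ i k C, (RDA.step prio θ st).des i = some (k, C) → st.asg i = none →
        st.asg k = none → ∃ a, best (θ i) (remItems st.asg) = some a ∧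
        owner prio st.asg a = some k ∧ best (θ i) C = some a ∧
        ∀ b ∈ C, b ∈ remItems st.asg ∧ owner prio st.asg b = some k := by
      intro i k C hd hi hk
      by_cases hact : IsActiveOwner prio st i
      · obtain ⟨a, k', ha, hak, -, hd'⟩ := h3 i hact
        rw [hd] at hd'
        simp only [Option.some.injEq, Prod.mk.injEq] at hd'
        obtain ⟨rfl, rfl⟩ := hd'
        exact ⟨a, ha, hak, best_of_subset ha (fun b hb => (mem_owned.1 hb).1)
          (mem_owned.2 ⟨mem_of_best ha, hak⟩), fun b hb => mem_owned.1 hb⟩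
      · rw [h4 i hact] at hd
        exact h.des i k C hd hi hk
    have hpt : ∀ {i k}, Designates st.asg (RDA.step prio θ st).des i k →
        PointsTo prio θ st.asg i k := by
      rintro i k ⟨hi, hk, C, hC⟩
      obtain ⟨a, ha, hak, -⟩ := hdes i k C hC hi hk
      exact ⟨mem_remAgents.2 hi, a, ha, hak⟩
    have hcyc : ∀ i, TransGen (Designates st.asg (RDA.step prio θ st).des) i i →
        (RDA.step prio θ st).menu i ≠ none := by
      intro i hi
      obtain ⟨k, ⟨-, -, C, hC⟩, -⟩ := TransGen.head'_iff.1 hi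
      rw [(h5 i C).2 ⟨hi, k, hC⟩]
      simp
    refine ⟨h1 ▸ h.reachable, h1 ▸ hdes, h1 ▸ hcyc, ?_, by simp [h2], fun _ => ?_, by simp [h2],
      by simp [h2]⟩
    · intro i C hiC
      obtain ⟨hc, k, hk⟩ := (h5 i C).1 hiC
      obtain ⟨k', hik, hki⟩ := TransGen.head'_iff.1 hc
      obtain ⟨hi, hk', C', hC'⟩ := id hik
      rw [hk] at hC'
      simp only [Option.some.injEq, Prod.mk.injEq] at hC'
      obtain ⟨rfl, rfl⟩ := hC'
      obtain ⟨a, ha, hak, haC, hC⟩ := hdes i k C hk hi hk'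
      rw [h1]
      exact ⟨a, k, ha, hak, hi, haC, hcyc k (.tail' hki hik), hC, hki⟩
    -- Every owner now designates a remaining owner, either newly or from an earlier stage, so a
    -- cycle exists and somebody gets a menu.
    · obtain ⟨i, hi⟩ := hq
      obtain ⟨j, hj⟩ := exists_transGen_self
        (r := Designates st.asg (RDA.step prio θ st).des) (v := {j | j ∈ owners prio st.asg})
        (owners_nonempty hcard hi) (by
          intro j hj
          have hjn := asg_eq_none_of_mem_owners hj
          by_cases hact : IsActiveOwner prio st j
          · obtain ⟨a, k, -, hak, -, hd⟩ := h3 j hact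
            have hjk : Designates st.asg (RDA.step prio θ st).des j k :=
              ⟨hjn, asg_eq_none_of_owner hak, _, hd⟩
            exact ⟨k, (hpt hjk).mem_owners, hjk⟩
          · have hna := hact
            simp only [IsActiveOwner, not_and, not_forall, not_not] at hact
            obtain ⟨k, C, hkC, hk⟩ := hact hj
            have hjk : Designates st.asg (RDA.step prio θ st).des j k :=
              ⟨hjn, hk, C, by rw [h4 j hna, hkC]⟩
            exact ⟨k, (hpt hjk).mem_owners, hjk⟩)
      exact ⟨j, hcyc j hj⟩
  · rw [h.step_assertion hs]
    have hS := h.isTradingSet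
    refine ⟨h.reachable.tail ⟨_, hS, rfl⟩, ?_, ?_, by simp, by simp, by simp, by simp, ?_⟩
    -- The partner `k` stays, hence so do all items of `C`, with `k` as their owner.
    · intro i k C hd hi hk
      obtain ⟨hiS, hi⟩ := hS.clear_eq_none_iff.1 hi
      obtain ⟨hkS, hk⟩ := hS.clear_eq_none_iff.1 hk
      obtain ⟨a, ha, hak, haC, hC⟩ := h.des i k C hd hi hk
      exact ⟨a, hS.best_clear hkS hak ha, hS.owner_clear hkS hak, haC, fun b hb =>
        ⟨hS.mem_remItems_clear hkS (hC b hb).2 (hC b hb).1, hS.owner_clear hkS (hC b hb).2⟩⟩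
    -- A cycle among the stayers was already a cycle before, so its members had menus and have left.
    · intro i hi
      obtain ⟨k, ⟨hik, -, -⟩, -⟩ := TransGen.head'_iff.1 hi
      refine ((hS.clear_eq_none_iff.1 hik).1 (h.cycle i (TransGen.mono ?_ _ _ hi))).elim
      rintro x y ⟨hx, hy, hd⟩
      exact ⟨(hS.clear_eq_none_iff.1 hx).2, (hS.clear_eq_none_iff.1 hy).2, hd⟩
    · intro _ hall
      obtain ⟨i, hi⟩ := h.exists_menu hs
      exact ((hS.clear_eq_none_iff.1 (hall i)).1 hi).elim

/-- As long as somebody remains, somebody is asked. -/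
theorem Inv.exists_question (hcard : Fintype.card N = Fintype.card A) (h : Inv prio θ st) {i : N}
    (hi : st.asg i = none) : ∃ j, question prio st j ≠ none := by
  rcases hs : st.sub
  · obtain ⟨j, hj⟩ := h.exists_active hcard (by simp [hs]) hi
    exact ⟨j, by simp [question, hs, hj]⟩
  · obtain ⟨j, hj⟩ := h.exists_active hcard (by simp [hs]) hi
    exact ⟨j, by simp [question, hs, hj]⟩
  · obtain ⟨j, hj⟩ := h.exists_menu hs
    exact ⟨j, by simpa [question, hs] using hj⟩

theorem Inv.asg_eq_none_of_question (h : Inv prio θ st) {i : N}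
    (hi : question prio st i ≠ none) : st.asg i = none := by
  rcases hs : st.sub
  · by_cases ha : IsActiveOwner prio st i
    · exact asg_eq_none_of_mem_owners ha.1
    · by_contra hne
      refine hi ?_
      have : ¬ ∀ j, st.asg j = none := fun hall => hne (hall i)
      simp only [question, hs, ha, this, if_false]
  · by_cases ha : IsActiveOwner prio st i
    · exact asg_eq_none_of_mem_owners ha.1
    · simp [question, hs, ha] at hi
  · have : st.menu i ≠ none := by simpa [question, hs] using hi
    obtain ⟨C, hC⟩ := Option.ne_none_iff_exists'.1 this
    obtain ⟨-, -, -, -, h', -⟩ := h.menu i C hC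
    exact h'

end Truthful

end RDA

namespace RDA

open TTC Relation GameForm

/-! ### Histories, reports and termination -/

section Histories

set_option linter.unusedSectionVars false

variable {N A : Type*} [Fintype N] [Fintype A] {prio : A → LinearOrder N}
  {θ : N → LinearOrder A} {h : Hist N A} {a : ActionProfile fun _ : N => Set (LinearOrder A)}

/-- The type profile `θ` is compatible with all reports along the history. -/
def Consistent (θ : N → LinearOrder A) (h : Hist N A) : Prop := ∀ i, θ i ∈ lastReport i h

theorem isHist_of_cons (hh : IsHist prio (a :: h)) : IsHist prio h := hh.1

theorem isHist_of_suffix {k : Hist N A} (hk : k <:+ h) (hh : IsHist prio h) : IsHist prio k := by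
  induction h with
  | nil => rwa [List.suffix_nil.1 hk]
  | cons a h ih =>
    rcases List.suffix_cons_iff.1 hk with rfl | hk
    · exact hh
    · exact ih hk hh.1

theorem action_eq_none (hh : IsHist prio (a :: h)) {i : N}
    (hq : question prio (stateAt prio h) i = none) : a i = none := by
  have := hh.2.2 i
  rwa [hq] at this

theorem exists_action (hh : IsHist prio (a :: h)) {i : N} {q : LinearOrder A → Answer N A}
    (hq : question prio (stateAt prio h) i = some q) : ∃ t ∈ lastReport i h,
      a i = some {t' | t' ∈ lastReport i h ∧ q t' = q t} := by
  have := hh.2.2 i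
  rwa [hq] at this

theorem exists_question_of_action (hh : IsHist prio (a :: h)) {i : N} {S : Set (LinearOrder A)}
    (hS : a i = some S) : ∃ q, question prio (stateAt prio h) i = some q ∧
      ∃ t ∈ lastReport i h, S = {t' | t' ∈ lastReport i h ∧ q t' = q t} := by
  rcases hq : question prio (stateAt prio h) i with _ | q
  · simp [action_eq_none hh hq] at hS
  · obtain ⟨t, ht, hat⟩ := exists_action hh hq
    exact ⟨q, rfl, t, ht, Option.some_inj.1 (hS.symm.trans hat)⟩

theorem lastReport_cons_subset (hh : IsHist prio (a :: h)) (i : N) :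
    lastReport i (a :: h) ⊆ lastReport i h := by
  rcases hS : a i with _ | S
  · simp [lastReport, hS]
  · obtain ⟨q, -, t, -, rfl⟩ := exists_question_of_action hh hS
    simp only [lastReport, hS, Option.getD_some]
    exact fun x hx => hx.1

theorem Consistent.of_cons (hh : IsHist prio (a :: h)) (hθ : Consistent θ (a :: h)) :
    Consistent θ h :=
  fun i => lastReport_cons_subset hh i (hθ i)

theorem Consistent.of_suffix {k : Hist N A} (hk : k <:+ h) (hh : IsHist prio h)
    (hθ : Consistent θ h) : Consistent θ k := by
  induction h with
  | nil => rwa [List.suffix_nil.1 hk]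
  | cons a h ih =>
    rcases List.suffix_cons_iff.1 hk with rfl | hk
    · exact hθ
    · exact ih hk hh.1 (hθ.of_cons hh)

theorem nonempty_linearOrder (A : Type*) [Finite A] : Nonempty (LinearOrder A) := by
  obtain ⟨n, ⟨e⟩⟩ := Finite.exists_equiv_fin A
  exact ⟨LinearOrder.lift' e e.injective⟩

theorem lastReport_nonempty (hh : IsHist prio h) (i : N) : (lastReport i h).Nonempty := by
  induction h with
  | nil =>
    obtain ⟨r⟩ := nonempty_linearOrder A
    exact ⟨r, trivial⟩
  | cons a h ih =>
    rcases hS : a i with _ | S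
    · simpa [lastReport, hS] using ih hh.1
    · obtain ⟨q, -, t, ht, rfl⟩ := exists_question_of_action hh hS
      exact ⟨t, by simp [lastReport, hS, ht]⟩

theorem exists_consistent (hh : IsHist prio h) : ∃ θ, Consistent θ h := by
  choose θ hθ using fun i => lastReport_nonempty hh i
  exact ⟨θ, hθ⟩

/-- All types in a report give the same answer, so the representative chosen by `answerOf` may be
replaced by `θ i`. -/
theorem stateAt_cons (hh : IsHist prio (a :: h)) (hθ : Consistent θ (a :: h)) :
    stateAt prio (a :: h) = step prio θ (stateAt prio h) := by
  rw [stateAt, step]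
  congr 1
  funext i
  unfold truthful
  rcases hq : question prio (stateAt prio h) i with _ | q
  · rfl
  · obtain ⟨t, ht, hat⟩ := exists_action hh hq
    have hi := hθ i
    simp only [lastReport, hat, Option.getD_some, Set.mem_ofPred_eq] at hi
    have hne : {t' | t' ∈ lastReport i h ∧ q t' = q t}.Nonempty := ⟨_, hi⟩
    have hsome := hne.some_mem
    simp only [hat, answerOf, hne, dif_pos, Option.elim]
    rw [hsome.2, hi.2]

theorem inv_stateAt (hcard : Fintype.card N = Fintype.card A) (hh : IsHist prio h)
    (hθ : Consistent θ h) : Inv prio θ (stateAt prio h) := by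
  induction h with
  | nil => exact Inv.init
  | cons a h ih =>
    have hi := ih hh.1 (hθ.of_cons hh)
    rw [stateAt_cons hh hθ]
    obtain ⟨i, hai⟩ := hh.2.1
    obtain ⟨S, hS⟩ := Option.isSome_iff_exists.1 hai
    obtain ⟨q, hq, -⟩ := exists_question_of_action hh hS
    exact hi.step hcard ⟨i, hi.asg_eq_none_of_question (by simp [hq])⟩

variable (prio h θ) in
/-- The truthful reports of the type profile `θ` at the history `h`. -/
noncomputable def reports : ActionProfile fun _ : N => Set (LinearOrder A) :=
  fun i => (question prio (stateAt prio h) i).map fun q =>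
    {t | t ∈ lastReport i h ∧ q t = q (θ i)}

theorem isHist_reports_cons (hh : IsHist prio h) (hθ : Consistent θ h)
    (hq : ∃ i, question prio (stateAt prio h) i ≠ none) :
    IsHist prio (reports prio θ h :: h) := by
  refine ⟨hh, ?_, fun i => ?_⟩
  · obtain ⟨i, hi⟩ := hq
    exact ⟨i, by simpa [reports, Option.isSome_iff_ne_none] using hi⟩
  · rcases hq : question prio (stateAt prio h) i with _ | q
    · simp [reports, hq]
    · exact ⟨θ i, hθ i, by simp [reports, hq]⟩

theorem mem_available_iff {i : N} {S : Set (LinearOrder A)} :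
    S ∈ (mechanism prio).available i h ↔ IsHist prio h ∧
      ∃ q, question prio (stateAt prio h) i = some q ∧ ∃ t ∈ lastReport i h,
        S = {t' | t' ∈ lastReport i h ∧ q t' = q t} := by
  classical
  constructor
  · rintro ⟨a, hh, haS⟩
    exact ⟨isHist_of_cons hh, exists_question_of_action hh haS⟩
  · rintro ⟨hh, q, hq, t, ht, rfl⟩
    obtain ⟨θ, hθ⟩ := exists_consistent hh
    -- Consistency is a condition on each agent separately, so the type of `i` can be replaced by
    -- `t` alone; the truthful reports of this profile realize the action.
    have hθ' : Consistent (Function.update θ i t) h := by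
      intro j
      by_cases hj : j = i
      · subst hj; simpa using ht
      · simpa [hj] using hθ j
    exact ⟨_, isHist_reports_cons hh hθ' ⟨i, by simp [hq]⟩, by simp [reports, hq]⟩

theorem isActive_iff {i : N} : (mechanism prio).IsActive i h ↔
    IsHist prio h ∧ question prio (stateAt prio h) i ≠ none := by
  constructor
  · rintro ⟨S, hS⟩
    obtain ⟨hh, q, hq, -⟩ := mem_available_iff.1 hS
    exact ⟨hh, by simp [hq]⟩
  · rintro ⟨hh, hq⟩
    obtain ⟨q, hq⟩ := Option.ne_none_iff_exists'.1 hq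
    obtain ⟨t, ht⟩ := lastReport_nonempty hh i
    exact ⟨_, mem_available_iff.2 ⟨hh, q, hq, t, ht, rfl⟩⟩

theorem isActive_iff_isSome (hh : IsHist prio (a :: h)) {i : N} :
    (mechanism prio).IsActive i h ↔ (a i).isSome := by
  rw [isActive_iff]
  constructor
  · rintro ⟨-, hq⟩
    obtain ⟨q, hq⟩ := Option.ne_none_iff_exists'.1 hq
    obtain ⟨t, -, ht⟩ := exists_action hh hq
    simp [ht]
  · intro hs
    obtain ⟨S, hS⟩ := Option.isSome_iff_exists.1 hs
    obtain ⟨q, hq, -⟩ := exists_question_of_action hh hS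
    exact ⟨hh.1, by simp [hq]⟩

theorem asg_ne_none_of_isTerminal (hcard : Fintype.card N = Fintype.card A)
    (hz : (mechanism prio).IsTerminal h) (i : N) : (stateAt prio h).asg i ≠ none := by
  intro hi
  obtain ⟨hh, hend⟩ := hz
  obtain ⟨θ, hθ⟩ := exists_consistent hh
  exact hend _ (isHist_reports_cons hh hθ ((inv_stateAt hcard hh hθ).exists_question hcard hi))

theorem outcome_eq_ttc (hcard : Fintype.card N = Fintype.card A)
    (hz : (mechanism prio).IsTerminal h) (hθ : Consistent θ h) :
    (stateAt prio h).asg = ttc prio θ :=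
  (inv_stateAt hcard hz.1 hθ).reachable.eq_of_full reachable_ttc
    (asg_ne_none_of_isTerminal hcard hz) (ttc_ne_none hcard)

/-- A potential that decreases along histories. -/
noncomputable def potential (st : State N A) : ℕ :=
  3 * (remAgents st.asg).card + match st.sub with
    | .renunciation => 2
    | .designation => 1
    | .assertion => 0

/-- Returning from assertion to renunciation raises the sub-stage term by 2, but at least one agent,
with weight 3, leaves. -/
theorem potential_step_lt {st : State N A} (hi : Inv prio θ st) :
    potential (step prio θ st) < potential st := by
  rcases hs : st.sub
  · by_cases hc : ∃ i, truthful prio θ st i = .claim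
    · obtain ⟨i, hc⟩ := hc
      obtain ⟨h1, -, h3, -⟩ := step_renunciation_claim hs hc
      simp [potential, h1, h3, hs]
    · rw [step_renunciation hs (by simpa using hc)]
      simp [potential, hs]
  · obtain ⟨h1, h2, -⟩ := step_designation (prio := prio) (θ := θ) hs
    simp [potential, h1, h2, hs]
  · have := hi.isTradingSet.card_remAgents_clear_lt (hi.exists_menu hs)
    rw [hi.step_assertion hs]
    simp only [potential, hs]
    omega

theorem length_add_potential_le (hcard : Fintype.card N = Fintype.card A)
    (hh : IsHist prio h) : h.length + potential (stateAt prio h) ≤ 3 * Fintype.card N + 2 := by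
  induction h with
  | nil =>
    have := Finset.card_le_univ (remAgents fun _ : N => (none : Option A))
    simp only [stateAt, State.init, potential, List.length_nil]
    omega
  | cons a h ih =>
    obtain ⟨θ, hθ⟩ := exists_consistent hh
    have := ih hh.1
    have := potential_step_lt (inv_stateAt hcard hh.1 (hθ.of_cons hh))
    rw [stateAt_cons hh hθ]
    simp only [List.length_cons]
    omega

/-! ### What the agents know -/

theorem lastReport_eq_of_experience (i : N) : lastReport i h =
    ((experience prio i h).head?.map Prod.snd).getD Set.univ := by
  induction h with
  | nil => rfl
  | cons a h ih =>
    rcases hS : a i with _ | S <;> simp [lastReport, experience, hS, ih]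

theorem ownActions_eq_of_experience (i : N) :
    ownActions i h = (experience prio i h).map Prod.snd := by
  unfold ownActions
  induction h with
  | nil => rfl
  | cons a h ih =>
    rcases hS : a i with _ | S <;> simp [experience, hS, ih]

/-- The menu `C` is determined by the experience `l`: it consists of the items which at the last
move had the same owner as the item that was the favorite one according to the last report. -/
def DeterminedBy (prio : A → LinearOrder N)
    (l : List ((SubStage × Finset N × Finset A) × Set (LinearOrder A))) (C : Finset A) : Prop :=
  ∃ sub O R S l', l = ((sub, O, R), S) :: l' ∧ S.Nonempty ∧ ∀ t ∈ S, ∃ b, best t R = some b ∧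
    ∀ c, c ∈ C ↔ c ∈ R ∧ best (prio c) O = best (prio b) O

theorem DeterminedBy.unique
    {l : List ((SubStage × Finset N × Finset A) × Set (LinearOrder A))} {C C' : Finset A}
    (hC : DeterminedBy prio l C) (hC' : DeterminedBy prio l C') : C = C' := by
  obtain ⟨sub, O, R, S, l', rfl, ⟨t, ht⟩, hS⟩ := hC
  obtain ⟨_, _, _, _, _, he, -, hS'⟩ := hC'
  simp only [List.cons.injEq, Prod.mk.injEq] at he
  obtain ⟨⟨⟨-, rfl, rfl⟩, rfl⟩, -⟩ := he
  obtain ⟨b, hb, hC⟩ := hS t ht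
  obtain ⟨b', hb', hC'⟩ := hS' t ht
  obtain rfl : b = b' := Option.some_inj.1 (hb.symm.trans hb')
  ext c
  rw [hC, hC']

/-- The owner of a remaining item belongs to `owners`, so maximizing priority over the announced
owners instead of all remaining agents changes nothing. -/
theorem best_owners {asg : N → Option A} {c : A} (hc : c ∈ remItems asg) {i : N}
    (hi : asg i = none) : best (prio c) (owners prio asg) = owner prio asg c := by
  obtain ⟨k, hk⟩ := exists_owner (prio := prio) c hi
  rw [hk]
  exact best_of_subset hk (fun j hj => mem_remAgents.2 (asg_eq_none_of_mem_owners hj))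
    (mem_owners.2 ⟨c, hc, hk⟩)

theorem mem_owned_iff_best {asg : N → Option A} {b : A} {k : N} (hb : b ∈ remItems asg)
    (hk : owner prio asg b = some k) (c : A) : c ∈ owned prio asg k ↔ c ∈ remItems asg ∧
      best (prio c) (owners prio asg) = best (prio b) (owners prio asg) := by
  have hn := asg_eq_none_of_owner hk
  rw [mem_owned]
  refine and_congr_right fun hc => ?_
  rw [best_owners hc hn, best_owners hb hn, hk]

theorem determinedBy_cons {i : N} {S : Set (LinearOrder A)} (hS : a i = some S)
    (hne : S.Nonempty) {C : Finset A} {k : N}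
    (h' : ∀ t ∈ S, ∃ b, best t (remItems (stateAt prio h).asg) = some b ∧
      owner prio (stateAt prio h).asg b = some k)
    (hC : C = owned prio (stateAt prio h).asg k) :
    DeterminedBy prio (experience prio i (a :: h)) C := by
  refine ⟨_, _, _, S, _, by simp only [experience, hS]; rfl, hne, fun t ht => ?_⟩
  obtain ⟨b, hb, hbk⟩ := h' t ht
  exact ⟨b, hb, fun c => by rw [hC]; exact mem_owned_iff_best (mem_of_best hb) hbk c⟩

theorem experience_cons_of_none {i : N} (ha : a i = none) :
    experience prio i (a :: h) = experience prio i h := by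
  simp [experience, ha]

theorem mem_of_action (hθ : Consistent θ (a :: h)) {i : N} {S : Set (LinearOrder A)}
    (hS : a i = some S) : θ i ∈ S := by
  have := hθ i
  simpa [lastReport, hS] using this

theorem truthful_of_mem_action (hh : IsHist prio (a :: h)) (hθ : Consistent θ (a :: h)) {i : N}
    {S : Set (LinearOrder A)} (hS : a i = some S) {t : LinearOrder A} (ht : t ∈ S) :
    truthful prio (fun _ => t) (stateAt prio h) i = truthful prio θ (stateAt prio h) i := by
  obtain ⟨q, hq, t', -, rfl⟩ := exists_question_of_action hh hS
  simp only [truthful, hq, Option.elim_some]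
  rw [ht.2, (mem_of_action hθ hS).2]

theorem exists_action_of_truthful (hh : IsHist prio (a :: h)) {i : N}
    (hi : truthful prio θ (stateAt prio h) i ≠ .pass) : ∃ S, a i = some S := by
  rcases hq : question prio (stateAt prio h) i with _ | q
  · simp [truthful, hq] at hi
  · obtain ⟨t, -, ht⟩ := exists_action hh hq
    exact ⟨_, ht⟩

/-- While a designation stands its author is asked nothing before she gets a menu, so it is still
her latest move; a claim is followed at once by its menu. -/
theorem determinedBy_experience (hcard : Fintype.card N = Fintype.card A)
    (hh : IsHist prio h) (i : N) (hi : (stateAt prio h).asg i = none) :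
    (∀ k C, (stateAt prio h).des i = some (k, C) → (stateAt prio h).asg k = none →
      DeterminedBy prio (experience prio i h) C) ∧
    ∀ C, (stateAt prio h).menu i = some C → DeterminedBy prio (experience prio i h) C := by
  induction h with
  | nil => simp [stateAt, State.init]
  | cons a h ih =>
    obtain ⟨θ, hθ⟩ := exists_consistent hh
    have hinv := inv_stateAt hcard hh.1 (hθ.of_cons hh)
    have hst := stateAt_cons hh hθ
    rcases hs : (stateAt prio h).sub
    · have hdes : ∀ k C, (stateAt prio h).des i = some (k, C) → (stateAt prio h).asg k = none →
          (stateAt prio h).asg i = none → DeterminedBy prio (experience prio i (a :: h)) C := by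
        intro k C hd hk hi
        -- A standing designation makes `i` inactive and shows that somebody has left, so she does
        -- not even make the degenerate move.
        have hact : ¬ IsActiveOwner prio (stateAt prio h) i := fun hact => hact.2 k C hd hk
        have hall : ¬ ∀ j, (stateAt prio h).asg j = none := fun hall => by
          simp [hinv.des_eq_none hs hall] at hd
        rw [experience_cons_of_none (action_eq_none hh (by simp [question, hs, hact, hall]))]
        exact (ih hh.1 hi).1 k C hd hk
      by_cases hc : ∃ j, truthful prio θ (stateAt prio h) j = .claim
      · obtain ⟨j, hj⟩ := hc
        obtain ⟨h1, h2, -, h4⟩ := step_renunciation_claim hs hj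
        rw [← hst] at h1 h2 h4
        rw [h1] at hi
        rw [h1, h2]
        refine ⟨fun k C hd hk => hdes k C hd hk hi, fun C hC => ?_⟩
        obtain ⟨hcl, hC⟩ := (h4 i C).1 hC
        obtain ⟨S, hS⟩ := exists_action_of_truthful (θ := θ) hh (i := i) (by simp [hcl])
        refine determinedBy_cons hS ⟨_, mem_of_action hθ hS⟩ (fun t ht => ?_) hC
        have hcl' := (truthful_of_mem_action hh hθ hS ht).trans hcl
        obtain ⟨-, b, hbi, hb⟩ := (truthful_eq_claim_iff hs).1 hcl'
        exact ⟨b, hb, (mem_owned.1 hbi).2⟩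
      · rw [hst, step_renunciation hs (by simpa using hc)] at hi ⊢
        refine ⟨fun k C hd hk => hdes k C hd hk hi, fun C hC => ?_⟩
        simp [hinv.menu_eq_none (by simp [hs])] at hC
    · obtain ⟨h1, -, h3, h4, h5⟩ := step_designation (prio := prio) (θ := θ) hs
      rw [← hst] at h1 h3 h4 h5
      rw [h1] at hi
      have hdes : ∀ k C, (stateAt prio (a :: h)).des i = some (k, C) →
          (stateAt prio h).asg k = none → DeterminedBy prio (experience prio i (a :: h)) C := by
        intro k C hd hk
        by_cases hact : IsActiveOwner prio (stateAt prio h) i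
        · obtain ⟨-, k', -, -, hans, hd'⟩ := h3 i hact
          rw [hd] at hd'
          simp only [Option.some.injEq, Prod.mk.injEq] at hd'
          obtain ⟨rfl, hC⟩ := hd'
          obtain ⟨S, hS⟩ := exists_action_of_truthful (θ := θ) hh (i := i) (by simp [hans])
          refine determinedBy_cons hS ⟨_, mem_of_action hθ hS⟩ (fun t ht => ?_) hC
          have hans' := (truthful_of_mem_action hh hθ hS ht).trans hans
          obtain ⟨b, k', hb, hbk, hans''⟩ := truthful_designation (θ := fun _ => t) hs hact
          rw [hans'] at hans''
          simp only [Answer.designate.injEq] at hans''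
          exact ⟨b, hb, hans''.symm ▸ hbk⟩
        · rw [experience_cons_of_none (action_eq_none hh (by simp [question, hs, hact]))]
          rw [h4 i hact] at hd
          exact (ih hh.1 hi).1 k C hd hk
      rw [h1]
      refine ⟨hdes, fun C hC => ?_⟩
      obtain ⟨hcyc, k, hk⟩ := (h5 i C).1 hC
      obtain ⟨k', ⟨-, hk', C', hd⟩, -⟩ := TransGen.head'_iff.1 hcyc
      rw [hk] at hd
      simp only [Option.some.injEq, Prod.mk.injEq] at hd
      exact hdes k C hk (hd.1 ▸ hk')
    · rw [hst, hinv.step_assertion hs] at hi ⊢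
      obtain ⟨hiS, hi⟩ := hinv.isTradingSet.clear_eq_none_iff.1 hi
      have hm : (stateAt prio h).menu i = none := by simpa using hiS
      rw [experience_cons_of_none (action_eq_none hh (by simp [question, hs, hm]))]
      refine ⟨fun k C hd hk => ?_, by simp⟩
      exact (ih hh.1 hi).1 k C hd (hinv.isTradingSet.clear_eq_none_iff.1 hk).2

theorem owned_congr {asg asg' : N → Option A} (ho : owners prio asg = owners prio asg')
    (hr : remItems asg = remItems asg') {i : N} (hi : asg i = none) (hi' : asg' i = none) :
    owned prio asg i = owned prio asg' i := by
  ext c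
  rw [mem_owned, mem_owned, ← hr]
  refine and_congr_right fun hc => ?_
  rw [← best_owners hc hi, ho, best_owners (hr ▸ hc) hi']

/-- The observation fixes the first two kinds of question through `best_owners`; a menu is recovered
from the experience. -/
theorem question_eq_of_sameInfo (hcard : Fintype.card N = Fintype.card A) {h' : Hist N A} {i : N}
    (ha : (mechanism prio).IsActive i h) (ha' : (mechanism prio).IsActive i h')
    (he : (mechanism prio).sameInfo i h h') :
    question prio (stateAt prio h) i = question prio (stateAt prio h') i := by
  obtain ⟨hh, hq⟩ := isActive_iff.1 ha
  obtain ⟨hh', hq'⟩ := isActive_iff.1 ha'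
  obtain ⟨hexp, hobs⟩ := he
  simp only [observation, Prod.mk.injEq] at hobs
  obtain ⟨hsub, ho, hr⟩ := hobs
  obtain ⟨θ, hθ⟩ := exists_consistent hh
  obtain ⟨θ', hθ'⟩ := exists_consistent hh'
  have hinv := inv_stateAt hcard hh hθ
  have hinv' := inv_stateAt hcard hh' hθ'
  have hi := hinv.asg_eq_none_of_question hq
  have hi' := hinv'.asg_eq_none_of_question hq'
  have howned := owned_congr ho hr hi hi'
  rcases hs : (stateAt prio h).sub
  · have hs' := hsub ▸ hs
    -- An inactive agent is asked only while nobody has left; then no designations exist, so an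
    -- owner would be active. Activity is thus visible from the announced owners.
    have key : ∀ {θ} {k : Hist N A}, Inv prio θ (stateAt prio k) →
        (stateAt prio k).sub = .renunciation → question prio (stateAt prio k) i ≠ none →
        (IsActiveOwner prio (stateAt prio k) i ↔ i ∈ owners prio (stateAt prio k).asg) ∧
        (¬ IsActiveOwner prio (stateAt prio k) i → ∀ j, (stateAt prio k).asg j = none) := by
      intro θ k hinv hs hq
      have h2 : ¬ IsActiveOwner prio (stateAt prio k) i → ∀ j, (stateAt prio k).asg j = none := by
        intro hact
        by_contra hall
        exact hq (by simp only [question, hs, hact, hall, if_false])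
      refine ⟨⟨fun h => h.1, fun h => ?_⟩, h2⟩
      by_contra hact
      exact hact ⟨h, by simp [hinv.des_eq_none hs (h2 hact)]⟩
    obtain ⟨h1, h2⟩ := key hinv hs hq
    obtain ⟨h1', h2'⟩ := key hinv' hs' hq'
    by_cases hact : IsActiveOwner prio (stateAt prio h) i
    · have hact' := h1'.2 (ho ▸ h1.1 hact)
      simp only [question, hs, hs', hact, hact', if_true, howned, hr]
    · have hact' : ¬ IsActiveOwner prio (stateAt prio h') i :=
        fun hc => hact (h1.2 (ho ▸ h1'.1 hc))
      simp only [question, hs, hs', hact, hact', if_false, h2 hact, h2' hact']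
  · have hs' := hsub ▸ hs
    have hact : IsActiveOwner prio (stateAt prio h) i := by
      by_contra hc
      exact hq (by simp [question, hs, hc])
    have hact' : IsActiveOwner prio (stateAt prio h') i := by
      by_contra hc
      exact hq' (by simp [question, hs', hc])
    simp only [question, hs, hs', hact, hact', if_true, hr, Option.some.injEq]
    funext t
    rcases hb : best t (remItems (stateAt prio h').asg) with _ | b
    · rfl
    · have hb' := mem_of_best hb
      simp only [Option.bind_some]
      rw [← best_owners hb' hi', ← ho, best_owners (hr ▸ hb') hi]
  · have hs' := hsub ▸ hs
    have hm : (stateAt prio h).menu i ≠ none := by simpa [question, hs] using hq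
    have hm' : (stateAt prio h').menu i ≠ none := by simpa [question, hs'] using hq'
    obtain ⟨C, hC⟩ := Option.ne_none_iff_exists'.1 hm
    obtain ⟨C', hC'⟩ := Option.ne_none_iff_exists'.1 hm'
    have hd := (determinedBy_experience hcard hh i hi).2 C hC
    have hd' := (determinedBy_experience hcard hh' i hi').2 C' hC'
    rw [hexp] at hd
    simp only [question, hs, hs', hC, hC', hd.unique hd']

theorem exists_prefix_of_experience {h' : Hist N A} (hh : IsHist prio h)
    (hh' : IsHist prio h') {i : N} (he : experience prio i h = experience prio i h')
    {k : Hist N A} (hk : k <:+ h) (hne : k ≠ h) (hak : (mechanism prio).IsActive i k) :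
    ∃ k', k' <:+ h' ∧ (mechanism prio).IsActive i k' ∧ (mechanism prio).sameInfo i k k' := by
  induction h generalizing h' with
  | nil => exact (hne (List.suffix_nil.1 hk)).elim
  | cons a h ih =>
    have hk' := (List.suffix_cons_iff.1 hk).resolve_left hne
    rcases hS : a i with _ | S
    · have hne' : k ≠ h := by
        rintro rfl
        simpa [hS] using (isActive_iff_isSome hh).1 hak
      rw [experience_cons_of_none hS] at he
      exact ih hh.1 hh' he hk' hne'
    · have he' : experience prio i h' = (observation prio (stateAt prio h), S) ::
          experience prio i h := by
        rw [← he]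
        simp [experience, hS]
      clear he
      -- Moves of `h'` at which `i` is silent are skipped until the one matching the latest entry is
      -- found.
      induction h' with
      | nil => simp [experience] at he'
      | cons b h' ih' =>
        rcases hT : b i with _ | T
        · rw [experience_cons_of_none hT] at he'
          obtain ⟨k', h1, h2⟩ := ih' hh'.1 he'
          exact ⟨k', h1.trans (List.suffix_cons _ _), h2⟩
        · simp only [experience, hT, List.cons.injEq, Prod.mk.injEq] at he'
          by_cases hkh : k = h
          · subst hkh
            exact ⟨h', List.suffix_cons _ _, (isActive_iff_isSome hh').2 (by simp [hT]),
              he'.2.symm, he'.1.1.symm⟩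
          · obtain ⟨k', h1, h2⟩ := ih hh.1 hh'.1 he'.2.symm hk' hkh
            exact ⟨k', h1.trans (List.suffix_cons _ _), h2⟩

/-! ### The gradual mechanism -/

theorem isDynamicGameForm (hcard : Fintype.card N = Fintype.card A) :
    (mechanism prio).IsDynamicGameForm where
  nil_mem := trivial
  pred_mem _ _ hh := isHist_of_cons hh
  finite_length := ⟨_, fun _ hh => le_of_add_le_left (length_add_potential_le hcard hh)⟩
  profile_nonempty _ _ hh := hh.2.1
  same_movers a b h hh hh' i := by
    rw [Bool.eq_iff_iff, ← isActive_iff_isSome hh, ← isActive_iff_isSome hh']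
  product h hh hnt a hact hinact := by
    refine ⟨hh, ?_, fun i => ?_⟩
    · have : ∃ b, b :: h ∈ (mechanism prio).hist := by
        by_contra! hc
        exact hnt ⟨hh, hc⟩
      obtain ⟨b, hb⟩ := this
      obtain ⟨i, hi⟩ := hb.2.1
      obtain ⟨x, -, hx⟩ := hact i ((isActive_iff_isSome hb).2 hi)
      exact ⟨i, by simp [hx]⟩
    · rcases hq : question prio (stateAt prio h) i with _ | q
      · exact hinact i fun hc => (isActive_iff.1 hc).2 hq
      · obtain ⟨x, hx, hax⟩ := hact i (isActive_iff.2 ⟨hh, by simp [hq]⟩)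
        obtain ⟨-, q', hq', t, ht, rfl⟩ := mem_available_iff.1 hx
        obtain rfl : q = q' := Option.some_inj.1 (hq.symm.trans hq')
        exact ⟨t, ht, hax⟩
  initial_active i := by
    refine isActive_iff.2 ⟨trivial, ?_⟩
    simp only [stateAt, State.init, question]
    split_ifs <;> simp_all
  info_equivalence i :=
    ⟨fun _ => ⟨rfl, rfl⟩, fun h => ⟨h.1.symm, h.2.symm⟩,
      fun h h' => ⟨h.1.trans h'.1, h.2.trans h'.2⟩⟩
  available_eq i h h' ha ha' he := by
    ext S
    rw [mem_available_iff, mem_available_iff, question_eq_of_sameInfo hcard ha ha' he,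
      lastReport_eq_of_experience (prio := prio) (h := h), he.1,
      ← lastReport_eq_of_experience (prio := prio)]
    simp [(isActive_iff.1 ha).1, (isActive_iff.1 ha').1]
  recall_actions i h h' _ _ he := by
    rw [ownActions_eq_of_experience (prio := prio), he.1, ← ownActions_eq_of_experience]
  recall_info i h h' ha ha' he k hk hak := by
    by_cases hkh : k = h
    · subst hkh
      exact ⟨h', List.suffix_rfl, ha', he⟩
    · exact exists_prefix_of_experience (isActive_iff.1 ha).1 (isActive_iff.1 ha').1 he.1 hk hkh hak

theorem isGradualMechanism (hcard : Fintype.card N = Fintype.card A) :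
    (mechanism prio).IsGradualMechanism (ttc prio) where
  gameForm := isDynamicGameForm hcard
  nonempty_of_available i h S hS := by
    obtain ⟨-, q, -, t, ht, rfl⟩ := mem_available_iff.1 hS
    exact ⟨t, ht, rfl⟩
  disjoint i h S hS S' hS' hne := by
    obtain ⟨-, q, hq, t, -, rfl⟩ := mem_available_iff.1 hS
    obtain ⟨-, q', hq', t', -, rfl⟩ := mem_available_iff.1 hS'
    obtain rfl : q = q' := Option.some_inj.1 (hq.symm.trans hq')
    refine Set.disjoint_left.2 fun x hx hx' => hne ?_
    rw [← hx.2, ← hx'.2]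
  sUnion_available i h ha := by
    obtain ⟨hh, hq⟩ := isActive_iff.1 ha
    obtain ⟨q, hq⟩ := Option.ne_none_iff_exists'.1 hq
    ext t
    simp only [Set.mem_sUnion]
    constructor
    · rintro ⟨S, hS, ht⟩
      obtain ⟨-, q', -, t', -, rfl⟩ := mem_available_iff.1 hS
      exact ht.1
    · intro ht
      exact ⟨_, mem_available_iff.2 ⟨hh, q, hq, t, ht, rfl⟩, ht, rfl⟩
  outcome_eq _ hz _ hθ := outcome_eq_ttc hcard hz hθ

end Histories

end RDA

namespace RDA

open TTC Relation GameForm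

/-! ### Secured items and coupled states -/

section Incentives

set_option linter.unusedSectionVars false

variable {N A : Type*} [Fintype N] [Fintype A] {prio : A → LinearOrder N}
  {θ θ' : N → LinearOrder A} {st st' : State N A} {i : N}

theorem Inv.step_asg_of_eq_some (hi : Inv prio θ st) {j : N} {b : A} (hb : st.asg j = some b) :
    (RDA.step prio θ st).asg j = some b := by
  rcases hs : st.sub
  · by_cases hc : ∃ j, truthful prio θ st j = .claim
    · obtain ⟨k, hk⟩ := hc
      rwa [(step_renunciation_claim hs hk).1]
    · rwa [step_renunciation hs (by simpa using hc)]
  · rwa [(step_designation hs).1]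
  · rw [hi.step_assertion hs]
    exact hi.isTradingSet.clear_of_eq_some hb

/-- Item `b` remains, and a chain of designations leads from its owner to the remaining agent
`i`. -/
def Secured (prio : A → LinearOrder N) (i : N) (b : A) (st : State N A) : Prop :=
  st.asg i = none ∧ b ∈ remItems st.asg ∧
    ∃ k, owner prio st.asg b = some k ∧ ReflTransGen (Designates st.asg st.des) k i

/-- Members of the chain are inactive before `i`, so they cannot redesignate; departing agents are
closed under designation, so none leaves before `i`. -/
theorem Secured.step {b : A} (hi : Inv prio θ st) (h : Secured prio i b st)
    (hm : st.menu i = none) : Secured prio i b (step prio θ st) := by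
  obtain ⟨hin, hb, k, hk, hki⟩ := h
  rcases hs : st.sub
  · by_cases hc : ∃ j, truthful prio θ st j = .claim
    · obtain ⟨j, hj⟩ := hc
      obtain ⟨h1, h2, -⟩ := step_renunciation_claim hs hj
      exact ⟨h1 ▸ hin, h1 ▸ hb, k, h1 ▸ hk, by rwa [h1, h2]⟩
    · rw [step_renunciation hs (by simpa using hc)]
      exact ⟨hin, hb, k, hk, hki⟩
  · obtain ⟨h1, -, -, h4, -⟩ := step_designation (prio := prio) (θ := θ) hs
    refine ⟨h1 ▸ hin, h1 ▸ hb, k, h1 ▸ hk, ?_⟩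
    rw [h1]
    refine ReflTransGen.mono ?_ _ _ hki
    rintro x y ⟨hx, hy, C, hC⟩
    exact ⟨hx, hy, C, by rw [h4 x (fun hact => hact.2 y C hC hy), hC]⟩
  · rw [hi.step_assertion hs]
    have hS := hi.isTradingSet
    -- The induction runs backwards along the chain from `i`, who stays because she has no menu.
    have key : ∀ x, ReflTransGen (Designates st.asg st.des) x i →
        x ∉ {j | st.menu j ≠ none} ∧ ReflTransGen
          (Designates (clear θ st.asg {j | st.menu j ≠ none}) st.des) x i := by
      intro x hx
      induction hx using ReflTransGen.head_induction_on with
      | refl => exact ⟨by simpa using hm, .refl⟩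
      | head hxy _ ih =>
        have hxS := fun hx => ih.1 (hi.menu_ne_none_of_designates hxy hx)
        exact ⟨hxS, ih.2.head ⟨hS.clear_eq_none_iff.2 ⟨hxS, hxy.1⟩,
          hS.clear_eq_none_iff.2 ⟨ih.1, hxy.2.1⟩, hxy.2.2⟩⟩
    obtain ⟨hkS, hki'⟩ := key k hki
    exact ⟨hS.clear_eq_none_iff.2 ⟨(key i .refl).1, hin⟩, hS.mem_remItems_clear hkS hk hb, k,
      hS.owner_clear hkS hk, hki'⟩

/-- The states of two histories that differ, if at all, only in the designation made by `i`. -/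
structure Coupled (i : N) (st st' : State N A) : Prop where
  asg : st.asg = st'.asg
  sub : st.sub = st'.sub
  des : ∀ j, j ≠ i → st.des j = st'.des j
  menu : ∀ j, j ≠ i → st.menu j = st'.menu j
  menu_left : st.menu i = none
  menu_right : st'.menu i = none
  asg_eq_none : st.asg i = none

theorem Coupled.question (hc : Coupled i st st') {j : N} (hj : j ≠ i) :
    question prio st j = question prio st' j := by
  have hact : IsActiveOwner prio st j = IsActiveOwner prio st' j := by
    simp only [IsActiveOwner, hc.asg, hc.des j hj]
  by_cases h : IsActiveOwner prio st j
  · have h' := hact ▸ h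
    simp only [RDA.question, h, h', hc.asg, hc.sub, hc.menu j hj]
  · have h' := hact ▸ h
    simp only [RDA.question, h, h', hc.asg, hc.sub, hc.menu j hj]

theorem Coupled.step_asg (hc : Coupled i st st')
    (ht : ∀ j, j ≠ i → truthful prio θ st j = truthful prio θ' st' j) :
    (step prio θ st).asg = (step prio θ' st').asg := by
  have hsub := hc.sub
  rcases hs : st.sub <;> rw [hs] at hsub
  · have key : ∀ {θ} {st : State N A}, st.sub = .renunciation → (step prio θ st).asg = st.asg := by
      intro θ st hs
      by_cases h : ∃ j, truthful prio θ st j = .claim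
      · exact (step_renunciation_claim hs h.choose_spec).1
      · rw [step_renunciation hs (by simpa using h)]
    rw [key hs, key hsub.symm, hc.asg]
  · rw [(step_designation hs).1, (step_designation hsub.symm).1, hc.asg]
  · simp only [step, next, hs, ← hsub]
    funext j
    by_cases hj : j = i
    · subst hj
      rw [truthful_assertion_of_none hs hc.menu_left,
        truthful_assertion_of_none hsub.symm hc.menu_right, hc.asg]
    · rw [ht j hj, hc.asg]

theorem Coupled.step_asg_eq_none (hi : Inv prio θ st) (hc : Coupled i st st') :
    (step prio θ st).asg i = none := by
  rcases hs : st.sub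
  · by_cases h : ∃ j, truthful prio θ st j = .claim
    · rw [(step_renunciation_claim hs h.choose_spec).1, hc.asg_eq_none]
    · rw [step_renunciation hs (by simpa using h)]
      exact hc.asg_eq_none
  · rw [(step_designation hs).1, hc.asg_eq_none]
  · rw [hi.step_assertion hs]
    exact hi.isTradingSet.clear_eq_none_iff.2 ⟨by simp [hc.menu_left], hc.asg_eq_none⟩

theorem Coupled.step_des (hc : Coupled i st st')
    (ht : ∀ j, j ≠ i → truthful prio θ st j = truthful prio θ' st' j) {j : N} (hj : j ≠ i) :
    (step prio θ st).des j = (step prio θ' st').des j := by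
  have hsub := hc.sub
  rcases hs : st.sub <;> rw [hs] at hsub
  · have key : ∀ {θ} {st : State N A}, st.sub = .renunciation → (step prio θ st).des = st.des := by
      intro θ st hs
      by_cases h : ∃ j, truthful prio θ st j = .claim
      · exact (step_renunciation_claim hs h.choose_spec).2.1
      · rw [step_renunciation hs (by simpa using h)]
    rw [key hs, key hsub.symm, hc.des j hj]
  · simp only [step, next, hs, ← hsub, newDes, ht j hj, hc.asg, hc.des j hj]
  · simp only [step, next, hs, ← hsub, hc.des j hj]

theorem designates_unique {asg : N → Option A} {des : N → Option (N × Finset A)} {j k k' : N}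
    (h : Designates asg des j k) (h' : Designates asg des j k') : k = k' := by
  obtain ⟨-, -, C, hC⟩ := h
  obtain ⟨-, -, C', hC'⟩ := h'
  rw [hC] at hC'
  simp only [Option.some.injEq, Prod.mk.injEq] at hC'
  exact hC'.1

/-- A cycle meeting `i` would be a cycle through `i`; the others use no designation of hers. -/
theorem transGen_designates_congr {asg : N → Option A} {des des' : N → Option (N × Finset A)}
    (hd : ∀ j, j ≠ i → des j = des' j) (hi : ¬ TransGen (Designates asg des) i i) {j : N}
    (hj : TransGen (Designates asg des) j j) : TransGen (Designates asg des') j j := by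
  refine transGen_congr (fun x y hjx hxy => ?_) hj
  have hx : x ≠ i := by
    rintro rfl
    have hxj := reflTransGen_back (r := Designates asg des)
      (fun _ _ _ h h' => designates_unique h h') hj hjx
    exact hi ((TransGen.trans_right hxj hj).trans_left hjx)
  obtain ⟨h1, h2, C, hC⟩ := hxy
  exact ⟨h1, h2, C, by rw [← hd x hx, hC]⟩

theorem Coupled.step (hc : Coupled i st st') (hi : Inv prio θ st)
    (hi₁ : Inv prio θ (step prio θ st)) (hi₁' : Inv prio θ' (RDA.step prio θ' st'))
    (ht : ∀ j, j ≠ i → truthful prio θ st j = truthful prio θ' st' j)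
    (hm : (RDA.step prio θ st).menu i = none) (hm' : (RDA.step prio θ' st').menu i = none) :
    Coupled i (RDA.step prio θ st) (RDA.step prio θ' st') := by
  have hasg := hc.step_asg ht
  have hdes := fun j hj => hc.step_des ht (j := j) hj
  suffices h : (RDA.step prio θ st).sub = (RDA.step prio θ' st').sub ∧
      ∀ j, j ≠ i → (RDA.step prio θ st).menu j = (RDA.step prio θ' st').menu j from
    ⟨hasg, h.1, hdes, h.2, hm, hm', hc.step_asg_eq_none hi⟩
  have hsub := hc.sub
  rcases hs : st.sub <;> rw [hs] at hsub
  · have key : ∀ {θ} {st : State N A}, st.sub = .renunciation →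
        -- A claim would give `i` a menu at once, so the claimants in both states are the same other
        -- agents.
        (RDA.step prio θ st).menu i = none → truthful prio θ st i ≠ .claim := by
      intro θ st hs hm hcl
      simp [((step_renunciation_claim hs hcl).2.2.2 i _).2 ⟨hcl, rfl⟩] at hm
    have hcl := key hs hm
    have hcl' := key hsub.symm hm'
    by_cases h : ∃ j, truthful prio θ st j = .claim
    · obtain ⟨j, hj⟩ := h
      have hji : j ≠ i := by rintro rfl; exact hcl hj
      obtain ⟨-, -, h3, h4⟩ := step_renunciation_claim hs hj
      obtain ⟨-, -, h3', h4'⟩ := step_renunciation_claim hsub.symm ((ht j hji).symm.trans hj)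
      refine ⟨h3.trans h3'.symm, fun l hl => Option.ext fun C => ?_⟩
      rw [h4, h4', ht l hl, hc.asg]
    · have h' : ∀ j, truthful prio θ' st' j ≠ .claim := by
        intro j hj
        by_cases hji : j = i
        · subst hji; exact hcl' hj
        · exact h ⟨j, (ht j hji).trans hj⟩
      rw [step_renunciation hs (by simpa using h), step_renunciation hsub.symm h']
      exact ⟨rfl, hc.menu⟩
  · obtain ⟨h1, h2, -, -, h5⟩ := step_designation (prio := prio) (θ := θ) hs
    obtain ⟨h1', h2', -, -, h5'⟩ := step_designation (prio := prio) (θ := θ') hsub.symm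
    refine ⟨h2.trans h2'.symm, fun j hj => Option.ext fun C => ?_⟩
    -- Lacking a menu, `i` lies on no cycle in either state, so the cycles agree.
    have hn := fun h => hi₁.cycle i h hm
    have hn' := fun h => hi₁'.cycle i h hm'
    rw [h5, h5', ← h1, ← h1', hdes j hj]
    rw [← hasg] at hn' ⊢
    refine and_congr_left fun _ => ⟨transGen_designates_congr hdes hn,
      transGen_designates_congr (fun j hj => (hdes j hj).symm) hn'⟩
  · simp only [RDA.step, next, hs, ← hsub]
    exact ⟨trivial, fun _ _ => trivial⟩

/-! ### Comparison of two plays -/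

theorem exists_cons_suffix {α : Type*} {h z : List α} (hz : h <:+ z) (hne : h ≠ z) :
    ∃ a, a :: h <:+ z := by
  obtain ⟨l, rfl⟩ := hz
  rcases List.eq_nil_or_concat l with rfl | ⟨l, a, rfl⟩
  · simp at hne
  · exact ⟨a, l, by simp⟩

theorem suffix_backward_induction {α : Type*} {z : List α} {P : List α → Prop}
    (H : ∀ h, h <:+ z → (∀ a, a :: h <:+ z → P (a :: h)) → P h) (h : List α) (hz : h <:+ z) :
    P h := by
  induction hn : z.length - h.length using Nat.strong_induction_on generalizing h with
  | _ n ih =>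
    refine H h hz fun a ha => ih _ ?_ _ ha rfl
    have := ha.length_le
    simp only [List.length_cons] at this ⊢
    omega

variable {h h' z z' : Hist N A}

theorem asg_eq_some_of_suffix (hcard : Fintype.card N = Fintype.card A) (hz : IsHist prio z)
    (hh : h <:+ z) {j : N} {b : A} (hb : (stateAt prio h).asg j = some b) :
    (stateAt prio z).asg j = some b := by
  induction z with
  | nil => rwa [← List.suffix_nil.1 hh]
  | cons a z ih =>
    rcases List.suffix_cons_iff.1 hh with rfl | hh
    · exact hb
    · obtain ⟨θ, hθ⟩ := exists_consistent hz
      rw [stateAt_cons hz hθ]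
      exact (inv_stateAt hcard hz.1 (hθ.of_cons hz)).step_asg_of_eq_some (ih hz.1 hh)

/-- An earlier holder of `b` would keep it to the end, and no two agents hold the same item. -/
theorem mem_remItems_of_suffix (hcard : Fintype.card N = Fintype.card A) (hz : IsHist prio z)
    (hh : h <:+ z) {b : A} (hi : (stateAt prio h).asg i = none)
    (hb : (stateAt prio z).asg i = some b) : b ∈ remItems (stateAt prio h).asg := by
  rw [mem_remItems]
  intro j hj
  obtain ⟨θ, hθ⟩ := exists_consistent hz
  have := (inv_stateAt hcard hz hθ).reachable.injective hb (asg_eq_some_of_suffix hcard hz hh hj)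
  subst this
  simp [hi] at hj

theorem exists_move (hcard : Fintype.card N = Fintype.card A)
    (hz : (mechanism prio).IsTerminal z) (hh : h <:+ z) (hi : (stateAt prio h).asg i = none) :
    ∃ a, a :: h <:+ z := by
  refine exists_cons_suffix hh ?_
  rintro rfl
  exact asg_ne_none_of_isTerminal hcard hz i hi

/-- An agent who chooses an item leaves with her favorite remaining item. -/
theorem asg_eq_best_of_menu (hcard : Fintype.card N = Fintype.card A)
    (hz : (mechanism prio).IsTerminal z) (hθ : Consistent θ z) (hh : h <:+ z)
    (hm : (stateAt prio h).menu i ≠ none) :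
    (stateAt prio z).asg i = best (θ i) (remItems (stateAt prio h).asg) := by
  have hinv := inv_stateAt hcard (isHist_of_suffix hh hz.1) (hθ.of_suffix hh hz.1)
  obtain ⟨C, hC⟩ := Option.ne_none_iff_exists'.1 hm
  obtain ⟨b, k, hb, -, hi, -⟩ := hinv.menu i C hC
  obtain ⟨a, ha⟩ := exists_move hcard hz hh hi
  have hs : (stateAt prio h).sub = .assertion := by
    by_contra hs
    exact hm (hinv.menu_eq_none hs i)
  rw [hb]
  refine asg_eq_some_of_suffix hcard hz.1 ha ?_
  rw [stateAt_cons (isHist_of_suffix ha hz.1) (hθ.of_suffix ha hz.1), hinv.step_assertion hs]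
  simp [clear, hC, hb]

theorem Secured.exists_le (hcard : Fintype.card N = Fintype.card A)
    (hz : (mechanism prio).IsTerminal z) (hθ : Consistent θ z) (hh : h <:+ z) {b : A}
    (hb : Secured prio i b (stateAt prio h)) :
    ∃ c, (stateAt prio z).asg i = some c ∧ (θ i).le b c := by
  revert hb
  refine suffix_backward_induction (z := z) (P := fun h => Secured prio i b (stateAt prio h) →
    ∃ c, (stateAt prio z).asg i = some c ∧ (θ i).le b c) (fun h hh ih hb => ?_) h hh
  by_cases hm : (stateAt prio h).menu i = none
  · obtain ⟨a, ha⟩ := exists_move hcard hz hh hb.1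
    have hinv := inv_stateAt hcard (isHist_of_suffix hh hz.1) (hθ.of_suffix hh hz.1)
    refine ih a ha ?_
    rw [stateAt_cons (isHist_of_suffix ha hz.1) (hθ.of_suffix ha hz.1)]
    exact hb.step hinv hm
  · rw [asg_eq_best_of_menu hcard hz hθ hh hm]
    obtain ⟨c, hc⟩ := exists_best (θ i) ⟨b, hb.2.1⟩
    exact ⟨c, hc, ((best_eq_some_iff _ _ _).1 hc).2 b hb.2.1⟩

theorem truthful_eq_of_action {a a' : ActionProfile fun _ : N => Set (LinearOrder A)}
    (ha : IsHist prio (a :: h)) (hθ : Consistent θ (a :: h))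
    (hθ' : Consistent θ' (a' :: h')) {j : N}
    (hq : question prio (stateAt prio h) j = question prio (stateAt prio h') j)
    (haa : a j = a' j) :
    truthful prio θ (stateAt prio h) j = truthful prio θ' (stateAt prio h') j := by
  rcases hS : a j with _ | S
  · rcases hq' : question prio (stateAt prio h) j with _ | q
    · simp [truthful, ← hq, hq']
    · obtain ⟨t, -, ht⟩ := exists_action ha hq'
      simp [hS] at ht
  · rw [← truthful_of_mem_action ha hθ hS (mem_of_action hθ' (haa ▸ hS))]
    simp only [truthful, hq]

/-- Both plays are followed in parallel until `i` gets a menu in one of them. Only `z` is truthful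
for the type `θ i` that judges the outcomes; `θ'` merely describes the reports along `z'`. -/
theorem prefers_of_coupled (hcard : Fintype.card N = Fintype.card A)
    (hz : (mechanism prio).IsTerminal z) (hz' : (mechanism prio).IsTerminal z')
    (hθ : Consistent θ z) (hθ' : Consistent θ' z')
    (hmoves : ∀ h h' a a', a :: h <:+ z → a' :: h' <:+ z' → ∀ j, j ≠ i →
      (mechanism prio).IsActive j h → (mechanism prio).IsActive j h' →
      (mechanism prio).sameInfo j h h' → a j = a' j)
    (hh : h <:+ z) (hh' : h' <:+ z') (hc : Coupled i (stateAt prio h) (stateAt prio h'))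
    (hexp : ∀ j, j ≠ i → experience prio j h = experience prio j h') :
    Prefers i (θ i) (stateAt prio z).asg (stateAt prio z').asg := by
  revert h'
  refine suffix_backward_induction (z := z) (P := fun h => ∀ {h' : Hist N A}, h' <:+ z' →
    Coupled i (stateAt prio h) (stateAt prio h') →
    (∀ j, j ≠ i → experience prio j h = experience prio j h') →
    Prefers i (θ i) (stateAt prio z).asg (stateAt prio z').asg)
    (fun h hh ih h' hh' hc hexp => ?_) h hh
  obtain ⟨a, ha⟩ := exists_move hcard hz hh hc.asg_eq_none
  obtain ⟨a', ha'⟩ := exists_move hcard hz' hh' (hc.asg ▸ hc.asg_eq_none)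
  have hah := isHist_of_suffix ha hz.1
  have hah' := isHist_of_suffix ha' hz'.1
  have hθa := hθ.of_suffix ha hz.1
  have hθa' := hθ'.of_suffix ha' hz'.1
  have hobs : observation prio (stateAt prio h) = observation prio (stateAt prio h') := by
    simp only [observation, hc.asg, hc.sub]
  have haa : ∀ j, j ≠ i → a j = a' j := by
    intro j hj
    rcases hq : question prio (stateAt prio h) j with _ | q
    · rw [action_eq_none hah hq, action_eq_none hah' ((hc.question hj).symm.trans hq)]
    · exact hmoves h h' a a' ha ha' j hj (isActive_iff.2 ⟨hah.1, by simp [hq]⟩)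
        (isActive_iff.2 ⟨hah'.1, by simp [← hc.question hj, hq]⟩) ⟨hexp j hj, hobs⟩
  have ht : ∀ j, j ≠ i → truthful prio θ (stateAt prio h) j =
      truthful prio θ' (stateAt prio h') j := fun j hj =>
    truthful_eq_of_action hah hθa hθa' (hc.question hj) (haa j hj)
  have hinv := inv_stateAt hcard hah.1 (hθa.of_cons hah)
  have hinv₁ := inv_stateAt hcard hah hθa
  have hinv₁' := inv_stateAt hcard hah' hθa'
  have hasg := hc.step_asg ht
  have hnone := hc.step_asg_eq_none hinv
  have hdes := fun j hj => hc.step_des ht (j := j) hj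
  have hstep := hc.step (θ := θ) (θ' := θ') (prio := prio) hinv
  rw [← stateAt_cons hah hθa] at hasg hnone hdes hstep
  rw [← stateAt_cons hah' hθa'] at hasg hdes hstep
  by_cases hm : (stateAt prio (a :: h)).menu i = none
  · by_cases hm' : (stateAt prio (a' :: h')).menu i = none
    · refine ih a ha ha' (hstep hinv₁ hinv₁' ht hm hm') fun j hj => ?_
      simp only [experience, haa j hj, hexp j hj, hobs]
    -- The deviation gives `i` a menu first: the chain from the owner of `b` to `i` can be cut at
    -- its first visit to `i`, so it also exists along `z` and secures `b`.
    · intro b hb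
      rw [asg_eq_best_of_menu hcard hz' hθ' ha' hm'] at hb
      obtain ⟨C, hC⟩ := Option.ne_none_iff_exists'.1 hm'
      obtain ⟨c, k, hc', -, -, hcC, -, hCk, hki⟩ := hinv₁'.menu i C hC
      obtain rfl : b = c := Option.some_inj.1 (hb.symm.trans hc')
      obtain ⟨hbr, hbk⟩ := hCk b (mem_of_best hcC)
      refine Secured.exists_le hcard hz hθ ha ⟨hnone, hasg ▸ hbr, k, hasg ▸ hbk, ?_⟩
      refine reflTransGen_congr_of_ne (fun x y hx hxy => ?_) hki
      obtain ⟨h1, h2, C, hC⟩ := hxy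
      exact ⟨hasg ▸ h1, hasg ▸ h2, C, (hdes x hx).trans hC⟩
  -- The play `z` gives `i` her favorite remaining item now, and whatever she ends up with along
  -- `z'` still remains.
  · intro b hb
    rw [asg_eq_best_of_menu hcard hz hθ ha hm]
    have hbr := mem_remItems_of_suffix hcard hz'.1 ha' (hasg ▸ hnone) hb
    rw [← hasg] at hbr
    obtain ⟨c, hc⟩ := exists_best (θ i) ⟨b, hbr⟩
    exact ⟨c, hc, ((best_eq_some_iff _ _ _).1 hc).2 b hbr⟩

theorem Coupled.init (i : N) : Coupled i (State.init : State N A) State.init :=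
  ⟨rfl, rfl, fun _ _ => rfl, fun _ _ => rfl, rfl, rfl, rfl⟩

theorem follows_of_suffix {s : ∀ i, (mechanism prio).Strategy i}
    (hs : (mechanism prio).Follows s z) (hh : h <:+ z) : (mechanism prio).Follows s h := by
  induction z with
  | nil => rwa [List.suffix_nil.1 hh]
  | cons a z ih =>
    rcases List.suffix_cons_iff.1 hh with rfl | hh
    · exact hs
    · exact ih hs.1 hh

theorem mem_lastReport_of_isUnconditional {s : ∀ i, (mechanism prio).Strategy i}
    {t : LinearOrder A} (hu : (mechanism prio).IsUnconditional (s i) t) (hz : IsHist prio z)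
    (hs : (mechanism prio).Follows s z) : t ∈ lastReport i z := by
  induction z with
  | nil => trivial
  | cons a z ih =>
    have ht := ih hz.1 hs.1
    rcases hS : a i with _ | S
    · simpa [lastReport, hS] using ht
    · have := hu z ((isActive_iff_isSome hz).2 (by simp [hS])) ht
      rw [← hs.2 i S hS] at this
      simpa [lastReport, hS] using this

theorem action_eq_of_follows {s : ∀ i, (mechanism prio).Strategy i}
    {a : ActionProfile fun _ : N => Set (LinearOrder A)} (hh : IsHist prio (a :: h))
    (hs : (mechanism prio).Follows s (a :: h)) (hi : (mechanism prio).IsActive i h) :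
    a i = some ((s i).act h) := by
  obtain ⟨S, hS⟩ := Option.isSome_iff_exists.1 ((isActive_iff_isSome hh).1 hi)
  rw [hS, hs.2 i S hS]

theorem isIncentiveCompatible (hcard : Fintype.card N = Fintype.card A) :
    (mechanism prio).IsIncentiveCompatible Prefers := by
  classical
  intro i t u hu s z z' hz hz'
  have hu' : (mechanism prio).IsUnconditional (Function.update s i u i) t := by simpa using hu
  have ht := mem_lastReport_of_isUnconditional hu' hz.1.1 (by convert hz.2)
  obtain ⟨θ, hθ⟩ := exists_consistent hz.1.1
  obtain ⟨θ', hθ'⟩ := exists_consistent hz'.1.1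
  -- An unconditional strategy keeps `t` in all reports of `i`, so the truthful play may be analyzed
  -- with `t` as her type.
  have hθt : Consistent (Function.update θ i t) z := by
    intro j
    by_cases hj : j = i
    · subst hj; simpa using ht
    · simpa [hj] using hθ j
  have := prefers_of_coupled (i := i) hcard hz.1 hz'.1 hθt hθ'
    (fun h h' a a' ha ha' j hj hact hact' hinfo => ?_) List.nil_suffix List.nil_suffix
    (Coupled.init i) fun _ _ => rfl
  · rw [Function.update_self] at this
    exact this
  · rw [action_eq_of_follows (isHist_of_suffix ha hz.1.1) (follows_of_suffix hz.2 ha) hact,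
      action_eq_of_follows (isHist_of_suffix ha' hz'.1.1) (follows_of_suffix hz'.2 ha') hact',
      Function.update_of_ne hj, (s j).act_info h h' hact hact' hinfo]

end Incentives

end RDA

theorem proposition11 {N A : Type*} [Fintype N] [Fintype A]
    (hcard : Fintype.card N = Fintype.card A) (prio : A → LinearOrder N) :
    (∀ θ : N → LinearOrder A, TTC.IsMatching (TTC.ttc prio θ)) ∧
      (RDA.mechanism prio).IsGradualMechanism (TTC.ttc prio) ∧
      (RDA.mechanism prio).IsIncentiveCompatible TTC.Prefers :=
  ⟨fun _ => TTC.isMatching_ttc hcard, RDA.isGradualMechanism hcard,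
    RDA.isIncentiveCompatible hcard⟩
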